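/- Let $V$ be a complex vector space of dimension $n$ and let $0\le r\le k\le n$, $s\ge 1$. Let $\operatorname{Gr}(k,V)\subset\mathbb P(\bigwedge^k V)$ be the Grassmannian in its Plücker embedding, with $\widehat E=e_1\wedge\cdots\wedge e_k$ for a basis of a $k$-plane $E$. For a projective variety $X\subset \mathbb P W$ let $\sigma_s(X)$ be its $s$-secant variety (the Zariski closure of the set of points in the span of $s$ points of $X$), with virtual dimension $s\dim X+s-1$ and expected dimension $\min\{\dim\mathbb P W,\ s\dim X+s-1\}$. Let $$\sigma_s^r(\operatorname{Gr}(k,V))=\overline{\{[\lambda_1\widehat E_1+\cdots+\lambda_s\widehat E_s] : E_i\in \operatorname{Gr}(k,V),\ \dim(E_1\cap\cdots\cap E_s)\ge r\}}\subset \mathbb P(\textstyle\bigwedge^kV)$$ be the $r$-restricted $s$-secant variety, with virtual dimension $r(n-r)+s(k-r)(n-k)+s-1$. The defect of a (restricted) secant variety is its virtual dimension minus its dimension. Assume the Baur–Draisma–de Graaf conjecture: for $s\ge1$ and $0\le m\le N$ the variety $\sigma_s(\operatorname{Gr}(m,\mathbb C^N))$ has the expected dimension unless, up to the duality $m\leftrightarrow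 N-m$, it is one of $\sigma_s(\operatorname{Gr}(2,N))$ with $s\ge 2$ and $2s+2\le N$, $\sigma_3(\operatorname{Gr}(3,7))$, $\sigma_3(\operatorname{Gr}(4,8))$, $\sigma_4(\operatorname{Gr}(4,8))$, $\sigma_4(\operatorname{Gr}(3,9))$. Then every restricted secant variety can be written with an overlap that cannot be increased: there is $q$ with $r\le q\le k$, $\sigma_s^{q}(\operatorname{Gr}(k,V))=\sigma_s^{r}(\operatorname{Gr}(k,V))$ and $\sigma_s^{q+1}(\operatorname{Gr}(k,V))\ne\sigma_s^{q}(\operatorname{Gr}(k,V))$. If $r$ itself is such an overlap, that is $\sigma_s^{r+1}(\operatorname{Gr}(k,V))\neq\sigma_s^{r}(\operatorname{Gr}(k,V))$, or if $r=0$, then $\sigma_s^r(\operatorname{Gr}(k,V))$ has no defect other than that of the ordinary secant variety: for every $r$-dimensional subspace $E\subset V$, 1. the defect of $\sigma_s^r(\operatorname{Gr}(k,V))$ equals the defect of $\sigma_s(\operatorname{Gr}(k-r,V/E))$; 2. $\dim\sigma_s^r(\operatorname{Gr}(k,V))=\dim\operatorname{Gr}(r,V)+\dim\sigma_s(\operatorname{Gr}(k-r,V/E))=\dim\operatorname{Gr}(r,V)+\dim\sigma_s(\operatorname{Gr}(k-r,\mathbb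 C^{n-r}))$; 3. if $\sigma_s(\operatorname{Gr}(k-r,\mathbb C^{n-r}))$ is not in the above list, then $$\dim\sigma_s^r(\operatorname{Gr}(k,V))=r(n-r)+\min\left\{\tbinom{n-r}{k-r}-1,\ s(k-r)(n-k)+s-1\right\}.$$ -/

import Mathlib

noncomputable section

namespace RestrictedSecant

/-- Polynomial functions on a complex vector space: the algebra of functions generated by the
linear forms. -/
def polyFun (W : Type*) [AddCommGroup W] [Module ℂ W] : Subalgebra ℂ (W → ℂ) :=
  Algebra.adjoin ℂ (Set.range fun φ : Module.Dual ℂ W => (φ : W → ℂ))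

/-- Homogeneous polynomial functions of degree `d`. -/
def IsHomogeneousForm {W : Type*} [AddCommGroup W] [Module ℂ W] (d : ℕ) (f : W → ℂ) : Prop :=
  f ∈ polyFun W ∧ ∀ (c : ℂ) (v : W), f (c • v) = c ^ d * f v

/-- Zariski closure in projective space: the common zeros of all forms vanishing on `X`. -/
def zariskiClosure {W : Type*} [AddCommGroup W] [Module ℂ W] (X : Set (Projectivization ℂ W)) :
    Set (Projectivization ℂ W) :=
  {p | ∀ (d : ℕ) (f : W → ℂ), IsHomogeneousForm d f → (∀ q ∈ X, f q.rep = 0) → f p.rep = 0}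

/-- The affine cone over `X`, including the origin. -/
def affineCone {W : Type*} [AddCommGroup W] [Module ℂ W] (X : Set (Projectivization ℂ W)) :
    Set W :=
  {v | ∀ hv : v ≠ 0, Projectivization.mk ℂ v hv ∈ X}

/-- Restriction of functions to the affine cone over `X`. -/
def restrictToCone {W : Type*} [AddCommGroup W] [Module ℂ W] (X : Set (Projectivization ℂ W)) :
    (W → ℂ) →ₐ[ℂ] (affineCone X → ℂ) where
  toFun f := fun v => f v
  map_one' := rfl
  map_mul' _ _ := rfl
  map_zero' := rfl
  map_add' _ _ := rfl
  commutes' _ := rfl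

/-- The homogeneous coordinate ring of `X`: polynomial functions restricted to the affine cone,
that is, the polynomial ring modulo the ideal of polynomials vanishing on the cone. -/
def homCoordRing {W : Type*} [AddCommGroup W] [Module ℂ W] (X : Set (Projectivization ℂ W)) :
    Subalgebra ℂ (affineCone X → ℂ) :=
  (polyFun W).map (restrictToCone X)

/-- The dimension of a projective variety: the transcendence degree of its homogeneous coordinate
ring (the dimension of the affine cone) minus one. The empty variety has dimension `-1`. -/
def projDim {W : Type*} [AddCommGroup W] [Module ℂ W] (X : Set (Projectivization ℂ W)) : ℤ :=
  (Cardinal.toNat (Algebra.trdeg ℂ (homCoordRing X)) : ℤ) - 1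

/-- `x = e₁ ∧ ⋯ ∧ e_k` for some basis `e₁, …, e_k` of the `k`-dimensional subspace `E`. -/
def IsPluckerRep {V : Type*} [AddCommGroup V] [Module ℂ V] (k : ℕ) (E : Submodule ℂ V)
    (x : ⋀[ℂ]^k V) : Prop :=
  ∃ e : Fin k → V, LinearIndependent ℂ e ∧ Submodule.span ℂ (Set.range e) = E ∧
    x = exteriorPower.ιMulti ℂ k e

/-- The Grassmannian of `k`-dimensional subspaces of `V` in its Plücker embedding. -/
def grassmannian (k : ℕ) (V : Type*) [AddCommGroup V] [Module ℂ V] :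
    Set (Projectivization ℂ (⋀[ℂ]^k V)) :=
  {p | ∃ (E : Submodule ℂ V) (x : ⋀[ℂ]^k V) (hx : x ≠ 0),
    IsPluckerRep k E x ∧ p = Projectivization.mk ℂ x hx}

/-- The `s`-secant variety of `X`: the Zariski closure of the set of points lying in the span of
`s` points of `X`. -/
def secantVariety {W : Type*} [AddCommGroup W] [Module ℂ W] (s : ℕ)
    (X : Set (Projectivization ℂ W)) : Set (Projectivization ℂ W) :=
  zariskiClosure {p | ∃ x : Fin s → Projectivization ℂ W, (∀ i, x i ∈ X) ∧
    p.rep ∈ Submodule.span ℂ (Set.range fun i => (x i).rep)}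

/-- The `r`-restricted `s`-secant variety of the Grassmannian of `k`-planes in `V`: the Zariski
closure of the set of points `[c₁ Ê₁ + ⋯ + c_s Ê_s]` with `dim (E₁ ∩ ⋯ ∩ E_s) ≥ r`. -/
def restrictedSecant (s r k : ℕ) (V : Type*) [AddCommGroup V] [Module ℂ V] :
    Set (Projectivization ℂ (⋀[ℂ]^k V)) :=
  zariskiClosure {p | ∃ (E : Fin s → Submodule ℂ V) (x : Fin s → ⋀[ℂ]^k V) (c : Fin s → ℂ)
    (h : ∑ i, c i • x i ≠ 0), (∀ i, IsPluckerRep k (E i) (x i)) ∧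
      r ≤ Module.finrank ℂ (⨅ i, E i : Submodule ℂ V) ∧ p = Projectivization.mk ℂ _ h}

/-- The virtual dimension `s · dim X + s - 1` of the `s`-secant variety of `X`. -/
def virtualDim {W : Type*} [AddCommGroup W] [Module ℂ W] (s : ℕ)
    (X : Set (Projectivization ℂ W)) : ℤ :=
  s * projDim X + s - 1

/-- The expected dimension of the `s`-secant variety of `X`. -/
def expectedDim {W : Type*} [AddCommGroup W] [Module ℂ W] (s : ℕ)
    (X : Set (Projectivization ℂ W)) : ℤ :=
  min ((Module.finrank ℂ W : ℤ) - 1) (virtualDim s X)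

/-- The defect of the `s`-secant variety of `X`, relative to the virtual dimension. -/
def secantDefect {W : Type*} [AddCommGroup W] [Module ℂ W] (s : ℕ)
    (X : Set (Projectivization ℂ W)) : ℤ :=
  virtualDim s X - projDim (secantVariety s X)

/-- The virtual dimension of the `r`-restricted `s`-secant variety of the Grassmannian of
`k`-planes in `n`-space: an `r`-plane `E`, then `s` planes of dimension `k - r` in the quotient by
`E`, then a point in the span of the resulting `s` points. -/
def restrictedVirtualDim (s r k n : ℕ) : ℤ :=
  (r : ℤ) * ((n : ℤ) - r) + s * (((k : ℤ) - r) * ((n : ℤ) - k)) + s - 1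

/-- The defect of the restricted secant variety, relative to its virtual dimension. -/
def restrictedDefect (s r k : ℕ) (V : Type*) [AddCommGroup V] [Module ℂ V] : ℤ :=
  restrictedVirtualDim s r k (Module.finrank ℂ V) - projDim (restrictedSecant s r k V)

/-- The list of known defective secant varieties `σ_s(Gr(k, n))`, up to the duality
`Gr(k, n) ≅ Gr(n - k, n)`. The varieties `σ_s(Gr(2, n))` (skew-symmetric matrices of rank at most
`2s`) are defective exactly for `2 ≤ s` and `2s + 2 ≤ n`. -/
def InDefectiveList (s k n : ℕ) : Prop :=
  ((k = 2 ∨ n = k + 2) ∧ 2 ≤ s ∧ 2 * s + 2 ≤ n) ∨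
  ((k = 3 ∨ k = 4) ∧ n = 7 ∧ s = 3) ∨
  (k = 4 ∧ n = 8 ∧ (s = 3 ∨ s = 4)) ∨
  ((k = 3 ∨ k = 6) ∧ n = 9 ∧ s = 4)

/-- The Baur–Draisma–de Graaf conjecture: outside the list, every secant variety of a Grassmannian
has the expected dimension. -/
def BDdGConjecture : Prop :=
  ∀ s k n : ℕ, 1 ≤ s → k ≤ n → ¬ InDefectiveList s k n →
    projDim (secantVariety s (grassmannian k (Fin n → ℂ))) =
      expectedDim s (grassmannian k (Fin n → ℂ))

end RestrictedSecant

end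

/-! The cone over the set defining `restrictedSecant` is the image of `secSum`, which sends (c, e,
f) to ∑ cᵢ e₁ ∧ ⋯ ∧ e_r ∧ fᵢ₁ ∧ ⋯ ∧ fᵢₘ with m = k - r (`range_secSum`). Passing to the closure
changes no dimension, so the dimension sought is the transcendence degree of the ring B of
polynomial functions pulled back along `secSum`, minus one.

Fix a frame e and a complement U of its span. A dense part of the parameters can be normalized to
common factors eⱼ + uⱼ and further factors in U, with uⱼ in U; the value is then (e + u) ∧ ω with ω
a sum for U without common factors. Let C be the ring of pullbacks of ω alone. Contracting with the
forms dual to e recovers ω, so C ⊆ B; expanding the wedge gives B ⊆ C[u], and the r · dim U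
coordinates of u are algebraically independent over C. If for one member the vectors v with v ∧ ω' =
0 are only those in the span of e, Cramer's rule makes the coordinates of u fractions of elements of
B, whence trdeg B = trdeg C + r · dim U (`Splitting.imageDim_secSum`).

Maximality of the overlap supplies such a member (`exists_general_secSum`). Otherwise every nonzero
ω' is killed by some v outside the span of its common factors; then ω' = v ∧ (d ⌟ ω') for a form d
with d(v) = 1 that vanishes on those factors. Contraction keeps decomposable vectors decomposable,
so v becomes one more common factor and the overlap increases.

The case s = 1, m = 0 gives dim Gr(r, V). Both virtual and actual dimensions thus exceed those of
the ordinary secant variety by r(n - r), so the defects agree; the conjecture enters only in the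
closed formula. -/

noncomputable section

namespace RestrictedSecant

open Algebra

/-! ### Polynomial functions, dimension of images, and Zariski closure -/

section PolyFun

variable {W W' : Type*} [AddCommGroup W] [Module ℂ W] [AddCommGroup W'] [Module ℂ W']

lemma dual_mem_polyFun (φ : Module.Dual ℂ W) : (φ : W → ℂ) ∈ polyFun W :=
  Algebra.subset_adjoin ⟨φ, rfl⟩

/-- A map is polynomial if composing it with linear forms gives polynomial functions. -/
def IsPolyMap (Φ : W → W') : Prop := ∀ φ : Module.Dual ℂ W', (fun w => φ (Φ w)) ∈ polyFun W

/-- Precomposition of functions with a fixed map, as a homomorphism of algebras. -/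
def precomp {ι κ : Type*} (Φ : ι → κ) : (κ → ℂ) →ₐ[ℂ] (ι → ℂ) where
  toFun f := f ∘ Φ
  map_one' := rfl
  map_mul' _ _ := rfl
  map_zero' := rfl
  map_add' _ _ := rfl
  commutes' _ := rfl

@[simp] lemma precomp_apply {ι κ : Type*} (Φ : ι → κ) (f : κ → ℂ) (i : ι) :
    precomp Φ f i = f (Φ i) := rfl

/-- The ring of pullbacks of polynomial functions along a map. -/
def pullbackRing {ι : Type*} (Φ : ι → W) : Subalgebra ℂ (ι → ℂ) :=
  (polyFun W).map (precomp Φ)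

lemma pullbackRing_eq_adjoin {ι : Type*} (Φ : ι → W) :
    pullbackRing Φ =
      Algebra.adjoin ℂ (Set.range fun φ : Module.Dual ℂ W => fun i => φ (Φ i)) := by
  rw [pullbackRing, polyFun, AlgHom.map_adjoin, ← Set.range_comp]
  rfl

lemma dual_mem_pullbackRing {ι : Type*} (Φ : ι → W) (φ : Module.Dual ℂ W) :
    (fun i => φ (Φ i)) ∈ pullbackRing Φ :=
  ⟨φ, dual_mem_polyFun φ, rfl⟩

lemma pullbackRing_le {ι : Type*} {Φ : ι → W} {S : Subalgebra ℂ (ι → ℂ)}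
    (h : ∀ φ : Module.Dual ℂ W, (fun i => φ (Φ i)) ∈ S) : pullbackRing Φ ≤ S := by
  rw [pullbackRing_eq_adjoin, Algebra.adjoin_le_iff]
  rintro _ ⟨φ, rfl⟩
  exact h φ

lemma pullbackRing_le_polyFun {Φ : W → W'} (h : IsPolyMap Φ) : pullbackRing Φ ≤ polyFun W :=
  pullbackRing_le h

/-- Every linear form on `W` extends along `j` through a left inverse. This permits computing in the
whole exterior algebra instead of `⋀[ℂ]^k V`. -/
lemma pullbackRing_comp_injective {ι : Type*} (Φ : ι → W) (j : W →ₗ[ℂ] W')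
    (hj : Function.Injective j) : pullbackRing (fun i => j (Φ i)) = pullbackRing Φ := by
  apply le_antisymm
  · exact pullbackRing_le fun φ => dual_mem_pullbackRing Φ (φ ∘ₗ j)
  · refine pullbackRing_le fun φ => ?_
    obtain ⟨g, hg⟩ := LinearMap.exists_leftInverse_of_injective j (LinearMap.ker_eq_bot.2 hj)
    have := dual_mem_pullbackRing (fun i => j (Φ i)) (φ ∘ₗ g)
    convert this using 2 with i
    simpa using (congrArg φ (LinearMap.congr_fun hg (Φ i))).symm

/-- The dimension of the closure of the image of a map, as the transcendence degree of the ring of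
pullbacks. -/
def imageDim {ι : Type*} (Φ : ι → W) : ℕ := Cardinal.toNat (Algebra.trdeg ℂ (pullbackRing Φ))

/-- The hypothesis says that the subfamily is Zariski dense, so restricting functions to it is
injective and the two pullback rings are isomorphic. -/
lemma imageDim_comp_of_dense {ι κ : Type*} (Φ : ι → W) (g : κ → ι)
    (hg : ∀ F ∈ polyFun W, (∀ x, F (Φ (g x)) = 0) → ∀ i, F (Φ i) = 0) :
    imageDim (fun x => Φ (g x)) = imageDim Φ := by
  let θ : pullbackRing Φ →ₐ[ℂ] (κ → ℂ) := (precomp g).comp (pullbackRing Φ).val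
  have hinj : Function.Injective θ := by
    rw [injective_iff_map_eq_zero]
    rintro ⟨_, F, hF, rfl⟩ h0
    ext i
    exact hg F hF (fun x => congrFun h0 x) i
  have hrange : θ.range = pullbackRing (fun x => Φ (g x)) := by
    rw [AlgHom.range_comp, Subalgebra.range_val, pullbackRing, pullbackRing, Subalgebra.map_map]
    rfl
  have e : pullbackRing Φ ≃ₐ[ℂ] pullbackRing (fun x => Φ (g x)) :=
    (AlgEquiv.ofInjective θ hinj).trans (Subalgebra.equivOfEq _ _ hrange)
  have := congrArg Cardinal.toNat e.lift_trdeg_eq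
  simpa [imageDim] using this.symm

lemma imageDim_comp_surjective {ι κ : Type*} (Φ : ι → W) {g : κ → ι} (hg : Function.Surjective g) :
    imageDim (fun x => Φ (g x)) = imageDim Φ :=
  imageDim_comp_of_dense Φ g fun F _ h i => by obtain ⟨x, rfl⟩ := hg i; exact h x

lemma projDim_eq_imageDim (X : Set (Projectivization ℂ W)) :
    projDim X = (imageDim (Subtype.val : affineCone X → W) : ℤ) - 1 := rfl

lemma projDim_eq_imageDim_of_range_eq {P : Type*} (X : Set (Projectivization ℂ W)) (j : W →ₗ[ℂ] W')
    (hj : Function.Injective j) (Ω : P → W') (h : Set.range Ω = j '' affineCone X) :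
    projDim X = (imageDim Ω : ℤ) - 1 := by
  have h1 : ∀ p, ∃ v : affineCone X, j v = Ω p := fun p => by
    obtain ⟨v, hv, hp⟩ := h ▸ Set.mem_range_self p
    exact ⟨⟨v, hv⟩, hp⟩
  choose g hg using h1
  have hsurj : Function.Surjective g := by
    intro v
    obtain ⟨p, hp⟩ : j v ∈ Set.range Ω := h ▸ ⟨v, v.2, rfl⟩
    exact ⟨p, Subtype.ext (hj ((hg p).trans hp))⟩
  have h2 : Ω = fun p => j (g p).1 := funext fun p => (hg p).symm
  rw [projDim_eq_imageDim, h2, ← imageDim_comp_surjective _ hsurj]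
  rw [imageDim, imageDim, pullbackRing_comp_injective (fun p => (g p).1) j hj]

lemma finiteType_pullbackRing [FiniteDimensional ℂ W] {ι : Type*} (Φ : ι → W) :
    Algebra.FiniteType ℂ (pullbackRing Φ) := by
  let b := Module.finBasis ℂ (Module.Dual ℂ W)
  classical
  rw [← Subalgebra.fg_iff_finiteType]
  refine ⟨Finset.univ.image fun i => fun x => b i (Φ x), le_antisymm ?_ ?_⟩
  · rw [Algebra.adjoin_le_iff]
    rintro f hf
    simp only [Finset.coe_image, Finset.coe_univ, Set.image_univ, Set.mem_range] at hf
    obtain ⟨i, rfl⟩ := hf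
    exact dual_mem_pullbackRing _ _
  · refine pullbackRing_le fun φ => ?_
    have : (fun i => φ (Φ i)) = ∑ l, b.repr φ l • fun x => b l (Φ x) := by
      ext x
      conv_lhs => rw [← b.sum_repr φ]
      simp only [LinearMap.coe_sum, Finset.sum_apply, LinearMap.smul_apply, Pi.smul_apply]
    rw [this]
    refine Subalgebra.sum_mem _ fun l _ => Subalgebra.smul_mem _ (Algebra.subset_adjoin ?_) _
    simp

/-- A polynomial function restricts to a polynomial on every line. -/
lemma exists_polynomial_of_mem_polyFun {F : W → ℂ} (hF : F ∈ polyFun W) (p v : W) :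
    ∃ h : Polynomial ℂ, ∀ t : ℂ, F (p + t • v) = h.eval t := by
  induction hF using Algebra.adjoin_induction with
  | mem x hx =>
    obtain ⟨φ, rfl⟩ := hx
    exact ⟨Polynomial.C (φ p) + Polynomial.C (φ v) * Polynomial.X,
      fun t => by simp only [map_add, map_smul, smul_eq_mul, Polynomial.eval_add,
        Polynomial.eval_C, Polynomial.eval_mul, Polynomial.eval_X, mul_comm]⟩
  | algebraMap c => exact ⟨Polynomial.C c, fun t => by simp⟩
  | add x y _ _ hx hy =>
    obtain ⟨f, hf⟩ := hx
    obtain ⟨g, hg⟩ := hy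
    exact ⟨f + g, fun t => by simp [hf, hg]⟩
  | mul x y _ _ hx hy =>
    obtain ⟨f, hf⟩ := hx
    obtain ⟨g, hg⟩ := hy
    exact ⟨f * g, fun t => by simp [hf, hg]⟩

/-- On the line through a point where `F` is nonzero and one where `G` is nonzero, both become
nonzero polynomials in one variable. -/
lemma eq_zero_or_eq_zero_of_mem_polyFun {F G : W → ℂ} (hF : F ∈ polyFun W) (hG : G ∈ polyFun W)
    (h : F * G = 0) : F = 0 ∨ G = 0 := by
  by_contra! hne
  obtain ⟨p, hp⟩ := Function.ne_iff.1 hne.1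
  obtain ⟨q, hq⟩ := Function.ne_iff.1 hne.2
  obtain ⟨f, hf⟩ := exists_polynomial_of_mem_polyFun hF p (q - p)
  obtain ⟨g, hg⟩ := exists_polynomial_of_mem_polyFun hG p (q - p)
  have hfg : f * g = 0 := Polynomial.funext fun t => by
    simpa [hf, hg] using congrFun h (p + t • (q - p))
  rcases mul_eq_zero.1 hfg with h0 | h0
  · exact hp (by simpa [h0] using hf 0)
  · exact hq (by simpa [h0] using hg 1)

lemma noZeroDivisors_of_le_polyFun {S : Subalgebra ℂ (W → ℂ)} (h : S ≤ polyFun W) :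
    NoZeroDivisors S where
  eq_zero_or_eq_zero_of_mul_eq_zero {a b} hab := by
    have := eq_zero_or_eq_zero_of_mem_polyFun (h a.2) (h b.2) (congrArg Subtype.val hab)
    exact this.imp Subtype.ext Subtype.ext

/-- The space of homogeneous forms of degree `d`. -/
def homogeneousForms (W : Type*) [AddCommGroup W] [Module ℂ W] (d : ℕ) : Submodule ℂ (W → ℂ) where
  carrier := {f | IsHomogeneousForm d f}
  add_mem' {f g} hf hg := ⟨add_mem hf.1 hg.1, fun c v => by simp [hf.2, hg.2, mul_add]⟩
  zero_mem' := ⟨zero_mem _, fun c v => by simp⟩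
  smul_mem' a f hf := ⟨Subalgebra.smul_mem _ hf.1 a, fun c v => by simp [hf.2]; ring⟩

lemma polyFun_le_iSup_homogeneousForms :
    Subalgebra.toSubmodule (polyFun W) ≤ ⨆ d, homogeneousForms W d := by
  rw [polyFun, Algebra.adjoin_eq_span, Submodule.span_le]
  intro f hf
  suffices ∃ d, f ∈ homogeneousForms W d by
    obtain ⟨d, hd⟩ := this
    exact Submodule.mem_iSup_of_mem d hd
  induction hf using Submonoid.closure_induction with
  | mem x hx =>
    obtain ⟨φ, rfl⟩ := hx
    exact ⟨1, dual_mem_polyFun φ, fun c v => by simp⟩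
  | one => exact ⟨0, one_mem _, fun c v => by simp⟩
  | mul x y _ _ hx hy =>
    obtain ⟨d, hd⟩ := hx
    obtain ⟨e, he⟩ := hy
    exact ⟨d + e, mul_mem hd.1 he.1, fun c v => by simp [hd.2, he.2, pow_add]; ring⟩

lemma exists_homogeneous_decomposition {F : W → ℂ} (hF : F ∈ polyFun W) :
    ∃ (I : Finset ℕ) (g : ℕ → W → ℂ), (∀ d, IsHomogeneousForm d (g d)) ∧ F = ∑ d ∈ I, g d := by
  obtain ⟨g, hg, hsum⟩ := (Submodule.mem_iSup_iff_exists_finsupp _ _).1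
    (polyFun_le_iSup_homogeneousForms hF)
  exact ⟨g.support, g, hg, hsum.symm⟩

lemma smul_mem_affineCone {X : Set (Projectivization ℂ W)} {v : W} (hv : v ∈ affineCone X) (c : ℂ) :
    c • v ∈ affineCone X := by
  intro hcv
  have hc : c ≠ 0 := by rintro rfl; simp at hcv
  have hv0 : v ≠ 0 := by rintro rfl; simp at hcv
  have : Projectivization.mk ℂ (c • v) hcv = Projectivization.mk ℂ v hv0 :=
    (Projectivization.mk_eq_mk_iff' ..).2 ⟨c, rfl⟩
  rw [this]
  exact hv hv0

lemma rep_mem_affineCone {X : Set (Projectivization ℂ W)} {p : Projectivization ℂ W} (hp : p ∈ X) :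
    p.rep ∈ affineCone X := fun h => by rwa [Projectivization.mk_rep]

/-- The sum is a polynomial in `c` whose coefficients are the values `g d v`; it vanishes
identically. -/
lemma homogeneous_component_eq_zero {I : Finset ℕ} {g : ℕ → W → ℂ}
    (hg : ∀ d, IsHomogeneousForm d (g d)) {v : W}
    (h : ∀ c : ℂ, ∑ d ∈ I, g d (c • v) = 0) {d : ℕ} (hd : d ∈ I) : g d v = 0 := by
  have h0 : ∑ e ∈ I, Polynomial.monomial e (g e v) = 0 := Polynomial.funext fun t => by
    rw [Polynomial.eval_finsetSum, Polynomial.eval_zero, ← h t]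
    exact Finset.sum_congr rfl fun e _ => by rw [Polynomial.eval_monomial, (hg e).2, mul_comm]
  have := congrArg (fun q => Polynomial.coeff q d) h0
  simpa [Polynomial.finsetSum_coeff, Polynomial.coeff_monomial, hd] using this

lemma subset_zariskiClosure (X : Set (Projectivization ℂ W)) : X ⊆ zariskiClosure X :=
  fun p hp _ _ _ h => h p hp

lemma eq_zero_on_affineCone_zariskiClosure {X : Set (Projectivization ℂ W)} {F : W → ℂ}
    (hF : F ∈ polyFun W) (h : ∀ v ∈ affineCone X, F v = 0) :
    ∀ v ∈ affineCone (zariskiClosure X), F v = 0 := by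
  intro v hv
  by_cases hv0 : v = 0
  -- The origin belongs to every affine cone, vacuously.
  · exact h v fun h => absurd hv0 h
  obtain ⟨I, g, hg, rfl⟩ := exists_homogeneous_decomposition hF
  rw [Finset.sum_apply]
  refine Finset.sum_eq_zero fun d hd => ?_
  have h1 : g d (Projectivization.mk ℂ v hv0).rep = 0 := by
    refine hv hv0 d (g d) (hg d) fun q hq => ?_
    refine homogeneous_component_eq_zero hg (fun c => ?_) hd
    simpa using h _ (smul_mem_affineCone (rep_mem_affineCone hq) c)
  obtain ⟨a, ha⟩ := Projectivization.exists_smul_eq_mk_rep ℂ v hv0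
  rw [← ha, Units.smul_def, (hg d).2] at h1
  exact (mul_eq_zero.1 h1).resolve_left (pow_ne_zero _ a.ne_zero)

lemma projDim_zariskiClosure (X : Set (Projectivization ℂ W)) :
    projDim (zariskiClosure X) = projDim X := by
  rw [projDim_eq_imageDim, projDim_eq_imageDim]
  have hle : affineCone X ⊆ affineCone (zariskiClosure X) := fun v hv h0 =>
    subset_zariskiClosure X (hv h0)
  rw [← imageDim_comp_of_dense (Subtype.val : affineCone (zariskiClosure X) → W)
    (Set.inclusion hle) fun F hF h v =>
      eq_zero_on_affineCone_zariskiClosure hF (fun v hv => h ⟨v, hv⟩) v v.2]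

end PolyFun

/-! ### Expansion of multilinear maps in a basis -/

section Multilinear

variable {V : Type*} [AddCommGroup V] [Module ℂ V]

lemma multilinear_expand {ι κ M : Type*} [Fintype ι] [Fintype κ] [DecidableEq ι]
    [AddCommGroup M] [Module ℂ M]
    (b : Module.Basis κ ℂ V) (g : MultilinearMap ℂ (fun _ : ι => V) M) (v : ι → V) :
    g v = ∑ J : ι → κ, (∏ i, b.coord (J i) (v i)) • g fun i => b (J i) := by
  conv_lhs => rw [show v = fun i => ∑ l, b.repr (v i) l • b l from
    funext fun i => (b.sum_repr (v i)).symm]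
  rw [MultilinearMap.map_sum]
  refine Finset.sum_congr rfl fun J _ => ?_
  rw [MultilinearMap.map_smul_univ]
  rfl

end Multilinear

/-! ### Transcendence degree of a ring between C and C[x] -/

section Trdeg

universe u

/-- `y` is a transcendence basis of `A` over `C`, and `A` is algebraic over `B`; additivity in the
towers K, C, A and K, B, A gives the two values of trdeg A. -/
lemma trdeg_eq_trdeg_add_card_of_tower {K ι : Type*} {C B A : Type u} [Field K] [CommRing C]
    [CommRing B] [CommRing A] [Algebra K C] [Algebra K B] [Algebra K A] [Algebra C B] [Algebra C A]
    [Algebra B A] [IsScalarTower K C A] [IsScalarTower K B A] [IsScalarTower C B A]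
    [IsDomain C] [IsDomain B] [IsDomain A] [FaithfulSMul C A] [FaithfulSMul B A] [Finite ι]
    (y : ι → A) (hy : AlgebraicIndependent C y) (htop : ∀ a : A, a ∈ adjoin C (Set.range y))
    (halg : ∀ i, IsAlgebraic B (y i)) :
    trdeg K B = trdeg K C + Nat.card ι := by
  have hbasis : IsTranscendenceBasis C y := by
    rw [hy.isTranscendenceBasis_iff_isAlgebraic]
    exact ⟨fun a => isAlgebraic_algebraMap (⟨a, htop a⟩ : Algebra.adjoin C (Set.range y))⟩
  have hBalg : Algebra.IsAlgebraic B A := hbasis.isAlgebraic_iff.2 halg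
  have h1 := trdeg_add_eq K C (A := A)
  have h2 := trdeg_add_eq K B (A := A)
  rw [trdeg_eq_zero (R := B) (A := A), add_zero] at h2
  rw [h2, ← h1]
  congr 1
  rw [← Cardinal.lift_inj, ← hbasis.lift_cardinalMk_eq_trdeg]
  have := Fintype.ofFinite ι
  simp

lemma trdeg_eq_trdeg_add_card {K F ι : Type*} [Field K] [CommRing F] [Nontrivial F] [Algebra K F]
    [Finite ι] (B C : Subalgebra K F) (x : ι → F)
    (hdom : NoZeroDivisors ↥(C ⊔ Algebra.adjoin K (Set.range x)))
    (hCB : C ≤ B) (hBA : B ≤ C ⊔ Algebra.adjoin K (Set.range x))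
    (hx : AlgebraicIndependent C x)
    (hq : ∀ i, ∃ q ∈ B, q ≠ 0 ∧ q * x i ∈ B) :
    Algebra.trdeg K B = Algebra.trdeg K C + Nat.card ι := by
  set A := C ⊔ Algebra.adjoin K (Set.range x) with hA
  have hCA : C ≤ A := le_sup_left
  have hxA : ∀ i, x i ∈ A := fun i =>
    (le_sup_right : _ ≤ A) (Algebra.subset_adjoin ⟨i, rfl⟩)
  let _ : Algebra C A := (Subalgebra.inclusion hCA).toAlgebra
  let _ : Algebra B A := (Subalgebra.inclusion hBA).toAlgebra
  let _ : Algebra C B := (Subalgebra.inclusion hCB).toAlgebra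
  have : IsScalarTower K C A := IsScalarTower.of_algebraMap_eq fun _ => rfl
  have : IsScalarTower K B A := IsScalarTower.of_algebraMap_eq fun _ => rfl
  have : IsScalarTower C B A := IsScalarTower.of_algebraMap_eq fun _ => rfl
  have : FaithfulSMul C A := (faithfulSMul_iff_algebraMap_injective C A).2
    (Subalgebra.inclusion_injective hCA)
  have : FaithfulSMul B A := (faithfulSMul_iff_algebraMap_injective B A).2
    (Subalgebra.inclusion_injective hBA)
  have : IsDomain A := NoZeroDivisors.to_isDomain A
  have : IsDomain B := (Subalgebra.inclusion_injective hBA).isDomain (Subalgebra.inclusion hBA)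
  have : IsDomain C := (Subalgebra.inclusion_injective hCA).isDomain (Subalgebra.inclusion hCA)
  let y : ι → A := fun i => ⟨x i, hxA i⟩
  have hy : AlgebraicIndependent C y := by
    let val : A →ₐ[C] F := { A.val with commutes' := fun _ => rfl }
    exact (val.algebraicIndependent_iff Subtype.val_injective).1 hx
  have hmem : ∀ a : A, a ∈ Algebra.adjoin C (Set.range y) := by
    have hle : A ≤ ((Algebra.adjoin C (Set.range y)).restrictScalars K).map A.val := by
      refine sup_le (fun c hc => ?_) (Algebra.adjoin_le ?_)
      · exact ⟨algebraMap C A ⟨c, hc⟩, (adjoin C (Set.range y)).algebraMap_mem ⟨c, hc⟩, rfl⟩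
      · rintro _ ⟨i, rfl⟩
        exact ⟨y i, Algebra.subset_adjoin ⟨i, rfl⟩, rfl⟩
    intro a
    obtain ⟨b, hb, hba⟩ := hle a.2
    rwa [← Subtype.ext (a1 := b) (a2 := a) hba]
  refine trdeg_eq_trdeg_add_card_of_tower y hy hmem fun i => ?_
  obtain ⟨q, hqB, hq0, hqx⟩ := hq i
  have hq0' : (⟨q, hqB⟩ : B) ≠ 0 := fun h => hq0 (congrArg Subtype.val h)
  -- A fraction with denominator `q` is a root of the linear polynomial qX - q·xᵢ over `B`.
  refine ⟨Polynomial.C ⟨q, hqB⟩ * Polynomial.X - Polynomial.C ⟨q * x i, hqx⟩, fun h => hq0' ?_, ?_⟩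
  · simpa using congrArg (fun p => Polynomial.coeff p 1) h
  · rw [map_sub, map_mul, Polynomial.aeval_C, Polynomial.aeval_C, Polynomial.aeval_X, sub_eq_zero]
    rfl

end Trdeg

open ExteriorAlgebra

local notation "wedge" => ExteriorAlgebra.ιMulti ℂ

/-! ### Wedge products and contractions -/

section Exterior

variable {V : Type*} [AddCommGroup V] [Module ℂ V]

lemma ι_mul_ι_swap (v w : V) : ι ℂ v * ι ℂ w = -(ι ℂ w * ι ℂ v) :=
  eq_neg_of_add_eq_zero_left (ι_add_mul_swap v w)

/-- Anticommutation carries the annihilation of `E` over to `ω * ι ℂ (f' 0)`, so the factors can be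
replaced one at a time. -/
lemma mul_ιMulti_congr (E : Submodule ℂ V) {m : ℕ} (f f' : Fin m → V)
    (h : ∀ l, f l - f' l ∈ E) (ω : ExteriorAlgebra ℂ V) (hω : ∀ v ∈ E, ω * ι ℂ v = 0) :
    ω * wedge m f = ω * wedge m f' := by
  induction m generalizing ω with
  | zero => simp
  | succ m ih =>
    rw [ιMulti_succ_apply, ιMulti_succ_apply, ← mul_assoc, ← mul_assoc]
    have h0 : ω * ι ℂ (f 0) = ω * ι ℂ (f' 0) := by
      rw [← sub_eq_zero, ← mul_sub, ← map_sub]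
      exact hω _ (h 0)
    rw [h0]
    refine ih _ _ (fun l => h l.succ) _ fun v hv => ?_
    rw [mul_assoc, ι_mul_ι_swap, mul_neg, ← mul_assoc, hω v hv, zero_mul, neg_zero]

lemma ι_mul_ιMulti_of_mem_span {r : ℕ} {e : Fin r → V} {v : V}
    (hv : v ∈ Submodule.span ℂ (Set.range e)) : ι ℂ v * wedge r e = 0 := by
  induction hv using Submodule.span_induction with
  | mem x hx =>
    obtain ⟨i, rfl⟩ := hx
    exact ι_mul_prod_list e i
  | zero => simp
  | add x y _ _ hx hy => rw [map_add, add_mul, hx, hy, add_zero]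
  | smul a x _ hx => rw [map_smul, smul_mul_assoc, hx, smul_zero]

lemma ιMulti_mul_ι {r : ℕ} (e : Fin r → V) (v : V) :
    wedge r e * ι ℂ v = (-1 : ℂ) ^ r • (ι ℂ v * wedge r e) := by
  induction r with
  | zero => simp
  | succ r ih =>
    rw [ιMulti_succ_apply, mul_assoc, ih, mul_smul_comm, ← mul_assoc, ← mul_assoc,
      ι_mul_ι_swap (e 0) v, neg_mul, pow_succ, mul_neg_one, neg_smul, smul_neg]

lemma ιMulti_mul_ι_of_mem_span {r : ℕ} {e : Fin r → V} {v : V}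
    (hv : v ∈ Submodule.span ℂ (Set.range e)) : wedge r e * ι ℂ v = 0 := by
  rw [ιMulti_mul_ι, ι_mul_ιMulti_of_mem_span hv, smul_zero]

/-- Contraction of the exterior algebra with a linear form. -/
def contract (d : Module.Dual ℂ V) : ExteriorAlgebra ℂ V →ₗ[ℂ] ExteriorAlgebra ℂ V :=
  CliffordAlgebra.contractLeft (Q := (0 : QuadraticForm ℂ V)) d

lemma contract_ι_mul (d : Module.Dual ℂ V) (v : V) (x : ExteriorAlgebra ℂ V) :
    contract d (ι ℂ v * x) = d v • x - ι ℂ v * contract d x :=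
  CliffordAlgebra.contractLeft_ι_mul d v x

lemma contract_one (d : Module.Dual ℂ V) : contract d (1 : ExteriorAlgebra ℂ V) = 0 :=
  CliffordAlgebra.contractLeft_one (Q := (0 : QuadraticForm ℂ V)) d

lemma contract_ιMulti_mul (d : Module.Dual ℂ V) {r : ℕ} (e : Fin r → V) (h : ∀ i, d (e i) = 0)
    (x : ExteriorAlgebra ℂ V) :
    contract d (wedge r e * x) = (-1 : ℂ) ^ r • (wedge r e * contract d x) := by
  induction r with
  | zero => simp
  | succ r ih =>
    rw [ιMulti_succ_apply, mul_assoc, contract_ι_mul, h 0, zero_smul, zero_sub,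
      ih (Matrix.vecTail e) (fun i => h i.succ), mul_smul_comm, mul_assoc, pow_succ, mul_neg_one,
      neg_smul]

lemma contract_ιMulti_eq_zero (d : Module.Dual ℂ V) {r : ℕ} (e : Fin r → V)
    (h : ∀ i, d (e i) = 0) : contract d (wedge r e) = 0 := by
  simpa [contract_one] using contract_ιMulti_mul d e h 1

/-- Iterated contraction with a family of linear forms. -/
def contractFrame : (r : ℕ) → (Fin r → Module.Dual ℂ V) →
    ExteriorAlgebra ℂ V →ₗ[ℂ] ExteriorAlgebra ℂ V
  | 0, _ => LinearMap.id
  | r + 1, d => contractFrame r (fun i => d i.succ) ∘ₗ contract (d 0)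

/-- Contracting with a dual frame strips off the frame; `hx` kills the terms in which a form hits
`x`. -/
lemma contractFrame_ιMulti_mul {r : ℕ} (d : Fin r → Module.Dual ℂ V) (e : Fin r → V)
    (h : ∀ i j, d i (e j) = if i = j then 1 else 0) (x : ExteriorAlgebra ℂ V)
    (hx : ∀ i, contract (d i) x = 0) : contractFrame r d (wedge r e * x) = x := by
  induction r with
  | zero => simp [contractFrame]
  | succ r ih =>
    rw [contractFrame, LinearMap.comp_apply, ιMulti_succ_apply, mul_assoc, contract_ι_mul, h 0 0,
      contract_ιMulti_mul (d 0) (Matrix.vecTail e)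
        (fun i => by simpa [Matrix.vecTail, (Fin.succ_ne_zero i).symm] using h 0 i.succ), hx 0]
    simp only [if_true, one_smul, mul_zero, smul_zero, sub_zero]
    exact ih _ _ (fun i j => by simpa [Matrix.vecTail] using h i.succ j.succ) fun i => hx i.succ

/-- The contraction of a decomposable vector is decomposable. -/
lemma exists_contract_ιMulti_eq (d : Module.Dual ℂ V) {m : ℕ} (f : Fin (m + 1) → V) :
    ∃ (c : ℂ) (f' : Fin m → V), contract d (wedge (m + 1) f) = c • wedge m f' := by
  by_cases h : ∃ l, d (f l) ≠ 0
  · obtain ⟨l, hl⟩ := h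
    set g := f ∘ Equiv.swap 0 l with hg
    have hg0 : d (g 0) ≠ 0 := by simpa [hg] using hl
    have hfg : wedge (m + 1) f = (Equiv.swap 0 l).sign • wedge (m + 1) g := by
      rw [hg, AlternatingMap.map_perm, smul_smul, Int.units_mul_self, one_smul]
    -- Subtracting multiples of `g 0` leaves the wedge unchanged and puts all other factors in the
    -- kernel of `d`.
    let f' : Fin m → V := fun i => g i.succ - (d (g i.succ) / d (g 0)) • g 0
    have h1 : wedge (m + 1) g = ι ℂ (g 0) * wedge m f' := by
      rw [ιMulti_succ_apply]
      refine mul_ιMulti_congr (Submodule.span ℂ {g 0}) _ _ (fun i => ?_) _ fun v hv => ?_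
      · simp only [Matrix.vecTail, Function.comp_apply, f', sub_sub_cancel]
        exact Submodule.smul_mem _ _ (Submodule.mem_span_singleton_self _)
      · obtain ⟨a, rfl⟩ := Submodule.mem_span_singleton.1 hv
        rw [map_smul, mul_smul_comm, ι_sq_zero, smul_zero]
    refine ⟨((Equiv.swap 0 l).sign : ℤ) * d (g 0), f', ?_⟩
    rw [hfg, h1, Units.smul_def, map_zsmul, contract_ι_mul, contract_ιMulti_eq_zero, mul_zero,
      sub_zero, mul_smul, Int.cast_smul_eq_zsmul]
    intro i
    simp [f', hg0]
  · push Not at h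
    exact ⟨0, 0, by rw [contract_ιMulti_eq_zero d f h, zero_smul]⟩

/-- On the `k`-dimensional span, every alternating `k`-linear map is a multiple of the determinant.
-/
lemma exists_ιMulti_eq_smul {k : ℕ} {e e' : Fin k → V} (he : LinearIndependent ℂ e)
    (h : ∀ i, e' i ∈ Submodule.span ℂ (Set.range e)) : ∃ c : ℂ, wedge k e' = c • wedge k e := by
  let b := Module.Basis.span he
  let S := Submodule.span ℂ (Set.range e)
  let g : S [⋀^Fin k]→ₗ[ℂ] ExteriorAlgebra ℂ V := (wedge k).compLinearMap S.subtype
  have hg : g = (LinearMap.toSpanSingleton ℂ _ (g b)).compAlternatingMap b.det := by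
    refine Module.Basis.ext_alternating b fun i hi => ?_
    let σ : Equiv.Perm (Fin k) := Equiv.ofBijective i (Finite.injective_iff_bijective.1 hi)
    change g (b ∘ σ) = (LinearMap.toSpanSingleton ℂ _ (g b)).compAlternatingMap b.det (b ∘ σ)
    rw [AlternatingMap.map_perm, AlternatingMap.map_perm]
    simp [Module.Basis.det_self]
  have hb : ∀ i, (b i : V) = e i := fun i => by simp [b, Module.Basis.span_apply]
  refine ⟨b.det fun i => ⟨e' i, h i⟩, ?_⟩
  have h1 := DFunLike.congr_fun hg fun i => ⟨e' i, h i⟩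
  have h2 : g b = wedge k e := by
    change wedge k (fun i => (b i : V)) = _
    simp only [hb]
  rw [LinearMap.compAlternatingMap_apply, LinearMap.toSpanSingleton_apply, h2] at h1
  exact h1

lemma linearIndependent_of_ιMulti_ne_zero {k : ℕ} {e : Fin k → V} (h : wedge k e ≠ 0) :
    LinearIndependent ℂ e := by
  by_contra hne
  exact h (AlternatingMap.map_linearDependent _ _ hne)

end Exterior

/-! ### Extending frames and splitting off a complement -/

section Frames

variable {V : Type*} [AddCommGroup V] [Module ℂ V]

/-- Extension of a linearly independent family to a basis of a subspace. -/
lemma exists_append_basis {r m : ℕ} {e : Fin r → V} (he : LinearIndependent ℂ e)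
    (E : Submodule ℂ V) (heE : ∀ i, e i ∈ E) (hE : Module.finrank ℂ E = r + m)
    [FiniteDimensional ℂ V] :
    ∃ f : Fin m → V, LinearIndependent ℂ (Fin.append e f) ∧
      Submodule.span ℂ (Set.range (Fin.append e f)) = E := by
  let e' : Fin r → E := fun i => ⟨e i, heE i⟩
  have he' : LinearIndependent ℂ e' := LinearIndependent.of_comp E.subtype he
  obtain ⟨T, hT⟩ := exists_isCompl (Submodule.span ℂ (Set.range e'))
  have hTm : Module.finrank ℂ T = m := by
    have := Submodule.finrank_add_eq_of_isCompl hT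
    rw [finrank_span_eq_card he', Fintype.card_fin] at this
    lia
  let b := Module.finBasisOfFinrankEq ℂ T hTm
  let f' : Fin m → E := fun i => b i
  have hf' : LinearIndependent ℂ f' := b.linearIndependent.map' T.subtype T.ker_subtype
  have hsum : LinearIndependent ℂ (Sum.elim e' f') := by
    refine he'.sum_type hf' (hT.disjoint.mono_right (Submodule.span_le.2 ?_))
    rintro _ ⟨i, rfl⟩
    exact (b i).2
  have happ : Fin.append e (fun i => (f' i : V)) =
      E.subtype ∘ Sum.elim e' f' ∘ finSumFinEquiv.symm := by
    ext i
    induction i using Fin.addCases <;> simp [e']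
  have hli : LinearIndependent ℂ (Fin.append e fun i => (f' i : V)) := by
    rw [happ]
    exact (hsum.comp _ finSumFinEquiv.symm.injective).map' E.subtype E.ker_subtype
  refine ⟨fun i => f' i, hli, Submodule.eq_of_le_of_finrank_eq (Submodule.span_le.2 ?_) ?_⟩
  · rintro _ ⟨i, rfl⟩
    rw [happ]
    exact Subtype.prop _
  · rw [finrank_span_eq_card hli, Fintype.card_fin, hE]

/-- A splitting of `V` as the span of the frame `e` plus a copy of `U`. -/
structure Splitting {r : ℕ} (e : Fin r → V) (U : Type*) [AddCommGroup U] [Module ℂ U] where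
  /-- The linear forms dual to the frame. -/
  coord : Fin r → Module.Dual ℂ V
  /-- The inclusion of the complement. -/
  incl : U →ₗ[ℂ] V
  /-- The projection to the complement. -/
  proj : V →ₗ[ℂ] U
  coord_frame : ∀ i j, coord i (e j) = if i = j then 1 else 0
  coord_incl : ∀ i u, coord i (incl u) = 0
  proj_frame : ∀ i, proj (e i) = 0
  proj_incl : ∀ u, proj (incl u) = u
  sum_eq : ∀ v, ∑ i, coord i v • e i + incl (proj v) = v

/-- `U` is any space of the right dimension, so both V/E and ℂ^(n-r) can play the complement. -/
lemma nonempty_splitting [FiniteDimensional ℂ V] {r : ℕ} {e : Fin r → V}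
    (he : LinearIndependent ℂ e) (U : Type*) [AddCommGroup U] [Module ℂ U] [FiniteDimensional ℂ U]
    (hU : r + Module.finrank ℂ U = Module.finrank ℂ V) : Nonempty (Splitting e U) := by
  obtain ⟨f, hf, hspan⟩ := exists_append_basis he ⊤ (fun _ => trivial)
    (finrank_top ℂ V |>.trans hU.symm)
  let b := Module.Basis.mk hf hspan.ge
  let c := Module.finBasis ℂ U
  have hbl : ∀ i, b (Fin.castAdd _ i) = e i := fun i => by simp [b]
  have hbr : ∀ i, b (Fin.natAdd _ i) = f i := fun i => by simp [b]
  let incl : U →ₗ[ℂ] V := c.constr ℂ f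
  let proj : V →ₗ[ℂ] U := b.constr ℂ (Fin.append 0 c)
  have hincl : ∀ l, incl (c l) = f l := fun l => c.constr_basis ℂ f l
  have hprojl : ∀ i, proj (e i) = 0 := fun i => by
    rw [← hbl, b.constr_basis, Fin.append_left, Pi.zero_apply]
  have hprojr : ∀ l, proj (f l) = c l := fun l => by
    rw [← hbr, b.constr_basis, Fin.append_right]
  have hcoordl : ∀ i j, b.coord (Fin.castAdd _ i) (e j) = if i = j then 1 else 0 := fun i j => by
    rw [← hbl, b.coord_apply, b.repr_self, Finsupp.single_apply]
    simp [eq_comm]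
  have hcoordr : ∀ i l, b.coord (Fin.castAdd _ i) (f l) = 0 := fun i l => by
    rw [← hbr, b.coord_apply, b.repr_self, Finsupp.single_apply, if_neg]
    intro h
    have := congrArg Fin.val h
    simp only [Fin.val_natAdd, Fin.val_castAdd] at this
    lia
  refine ⟨⟨fun i => b.coord (Fin.castAdd _ i), incl, proj, hcoordl, fun i u => ?_, hprojl,
    fun u => ?_, fun v => ?_⟩⟩
  · have : b.coord (Fin.castAdd _ i) ∘ₗ incl = 0 := c.ext fun l => by simp [hincl, hcoordr]
    exact LinearMap.congr_fun this u
  · have : proj ∘ₗ incl = LinearMap.id := c.ext fun l => by simp [hincl, hprojr]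
    exact LinearMap.congr_fun this u
  · have : ∑ i, LinearMap.toSpanSingleton ℂ V (e i) ∘ₗ b.coord (Fin.castAdd _ i) + incl ∘ₗ proj =
        LinearMap.id := by
      refine b.ext fun l => ?_
      induction l using Fin.addCases with
      | left l =>
        rw [hbl]
        simp [hcoordl, hprojl]
      | right l =>
        rw [hbr]
        simp [hcoordr, hprojr, hincl]
    simpa using LinearMap.congr_fun this v

end Frames

/-! ### Polynomial dependence on parameters -/

section PolyMaps

variable {P W : Type*} [AddCommGroup P] [Module ℂ P] [AddCommGroup W] [Module ℂ W]

lemma multilinear_mem_polyFun {V ι M : Type*} [AddCommGroup V] [Module ℂ V] [FiniteDimensional ℂ V]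
    [Fintype ι] [AddCommGroup M] [Module ℂ M]
    (g : MultilinearMap ℂ (fun _ : ι => V) M) (L : ι → P →ₗ[ℂ] V) (φ : Module.Dual ℂ M) :
    (fun p => φ (g fun i => L i p)) ∈ polyFun P := by
  classical
  let b := Module.finBasis ℂ V
  have : (fun p => φ (g fun i => L i p)) = ∑ J : ι → Fin (Module.finrank ℂ V),
      φ (g fun i => b (J i)) • ∏ i, ((b.coord (J i) ∘ₗ L i : Module.Dual ℂ P) : P → ℂ) := by
    ext p
    rw [multilinear_expand b g, map_sum, Finset.sum_apply]
    refine Finset.sum_congr rfl fun J _ => ?_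
    rw [map_smul, Pi.smul_apply, Finset.prod_apply, smul_eq_mul, smul_eq_mul, mul_comm]
    rfl
  rw [this]
  exact Subalgebra.sum_mem _ fun J _ => Subalgebra.smul_mem _
    (Subalgebra.prod_mem _ fun i _ => dual_mem_polyFun _) _

lemma comp_mem_polyFun {Φ : P → W} (hΦ : IsPolyMap Φ) {F : W → ℂ} (hF : F ∈ polyFun W) :
    (fun p => F (Φ p)) ∈ polyFun P :=
  pullbackRing_le_polyFun hΦ ⟨F, hF, rfl⟩

lemma IsPolyMap.comp_linear {P' : Type*} [AddCommGroup P'] [Module ℂ P'] {Φ : P → W}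
    (hΦ : IsPolyMap Φ) (L : P' →ₗ[ℂ] P) : IsPolyMap (fun p => Φ (L p)) :=
  fun φ => comp_mem_polyFun (Φ := L) (fun ψ => dual_mem_polyFun (ψ ∘ₗ L)) (hΦ φ)

lemma det_mem_subalgebra {ι κ : Type*} [Fintype κ] [DecidableEq κ] (S : Subalgebra ℂ (ι → ℂ))
    (N : κ → κ → ι → ℂ) (hN : ∀ i j, N i j ∈ S) :
    (fun q => (Matrix.of fun i j => N i j q).det) ∈ S := by
  have : (fun q => (Matrix.of fun i j => N i j q).det) =
      ∑ σ : Equiv.Perm κ, ((σ.sign : ℤ) : ℂ) • ∏ i, N (σ i) i := by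
    ext q
    simp [Matrix.det_apply, Units.smul_def]
  rw [this]
  exact Subalgebra.sum_mem _ fun σ _ => Subalgebra.smul_mem _
    (Subalgebra.prod_mem _ fun i _ => hN _ _) _

end PolyMaps

/-! ### Sums of decomposable vectors with common factors -/

/-- Parameters for a sum of `s` decomposable vectors with `r` common factors and `m` further
factors each. -/
abbrev SecParam (s r m : ℕ) (V : Type*) : Type _ :=
  (Fin s → ℂ) × (Fin r → V) × (Fin s → Fin m → V)

section SecSum

variable {V : Type*} [AddCommGroup V] [Module ℂ V]

/-- The sum `∑ cᵢ e₁ ∧ ⋯ ∧ e_r ∧ fᵢ₁ ∧ ⋯ ∧ fᵢₘ`. -/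
def secSum {s r m : ℕ} (p : SecParam s r m V) : ExteriorAlgebra ℂ V :=
  ∑ i, p.1 i • (wedge r p.2.1 * wedge m (p.2.2 i))

lemma isPolyMap_secSum [FiniteDimensional ℂ V] (s r m : ℕ) :
    IsPolyMap (secSum : SecParam s r m V → ExteriorAlgebra ℂ V) := by
  intro φ
  let Le : Fin r → SecParam s r m V →ₗ[ℂ] V := fun j =>
    LinearMap.proj j ∘ₗ LinearMap.fst ℂ _ _ ∘ₗ LinearMap.snd ℂ _ _
  let Lf : Fin s → Fin m → SecParam s r m V →ₗ[ℂ] V := fun i l =>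
    LinearMap.proj l ∘ₗ LinearMap.proj i ∘ₗ LinearMap.snd ℂ _ _ ∘ₗ LinearMap.snd ℂ _ _
  let Lc : Fin s → Module.Dual ℂ (SecParam s r m V) := fun i =>
    LinearMap.proj i ∘ₗ LinearMap.fst ℂ _ _
  have : (fun p : SecParam s r m V => φ (secSum p)) = ∑ i, (Lc i : SecParam s r m V → ℂ) *
      fun p => φ ((wedge (r + m)).toMultilinearMap fun l => Fin.append Le (Lf i) l p) := by
    ext p
    rw [secSum, map_sum, Finset.sum_apply]
    refine Finset.sum_congr rfl fun i _ => ?_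
    have h : Fin.append p.2.1 (p.2.2 i) = fun l => Fin.append Le (Lf i) l p := by
      ext l
      induction l using Fin.addCases <;> simp [Le, Lf]
    rw [map_smul, Pi.mul_apply, ιMulti_mul_ιMulti, smul_eq_mul, h]
    rfl
  rw [this]
  exact Subalgebra.sum_mem _ fun i _ => mul_mem (dual_mem_polyFun _)
    (multilinear_mem_polyFun _ _ φ)

lemma ι_mul_secSum_of_mem_span {s r m : ℕ} (p : SecParam s r m V) {v : V}
    (hv : v ∈ Submodule.span ℂ (Set.range p.2.1)) : ι ℂ v * secSum p = 0 := by
  simp [secSum, Finset.mul_sum, ← mul_assoc, ι_mul_ιMulti_of_mem_span hv]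

lemma secSum_congr {s r m : ℕ} (c : Fin s → ℂ) (e : Fin r → V) (f f' : Fin s → Fin m → V)
    (h : ∀ i l, f i l - f' i l ∈ Submodule.span ℂ (Set.range e)) :
    secSum (c, e, f) = secSum (c, e, f') :=
  Finset.sum_congr rfl fun i _ => congrArg (c i • ·) <|
    mul_ιMulti_congr _ _ _ (h i) _ fun _ hv => ιMulti_mul_ι_of_mem_span hv

instance [FiniteDimensional ℂ V] : FiniteDimensional ℂ (ExteriorAlgebra ℂ V) :=
  Module.Basis.finiteDimensional_of_finite (Module.finBasis ℂ V).ExteriorAlgebra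

end SecSum

/-! ### The affine chart around a frame -/

namespace Splitting

variable {V U : Type*} [AddCommGroup V] [Module ℂ V] [AddCommGroup U] [Module ℂ U] {r : ℕ}
  {e : Fin r → V} (S : Splitting e U)

lemma incl_proj_of_coord_eq_zero {v : V} (hv : ∀ i, S.coord i v = 0) : S.incl (S.proj v) = v := by
  simpa [hv] using S.sum_eq v

lemma proj_of_mem_span {v : V} (hv : v ∈ Submodule.span ℂ (Set.range e)) : S.proj v = 0 := by
  have : Submodule.span ℂ (Set.range e) ≤ LinearMap.ker S.proj := by
    rw [Submodule.span_le]
    rintro _ ⟨i, rfl⟩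
    exact S.proj_frame i
  exact this hv

/-- Frames in the affine chart of the Grassmannian around the span of `e`, together with further
vectors from the complement. -/
def chartParam {s m : ℕ} (q : (Fin r → U) × SecParam s 0 m U) : SecParam s r m V :=
  (q.2.1, fun j => e j + S.incl (q.1 j), fun i l => S.incl (q.2.2.2 i l))

/-- The sums of decomposable vectors parametrized by the affine chart. -/
def chart {s m : ℕ} (q : (Fin r → U) × SecParam s 0 m U) : ExteriorAlgebra ℂ V :=
  secSum (S.chartParam q)

lemma coord_chart (i j : Fin r) (u : U) :
    S.coord i (e j + S.incl u) = if i = j then 1 else 0 := by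
  rw [map_add, S.coord_frame, S.coord_incl, add_zero]

lemma chart_eq {s m : ℕ} (q : (Fin r → U) × SecParam s 0 m U) :
    S.chart q = wedge r (fun j => e j + S.incl (q.1 j)) * map S.incl (secSum q.2) := by
  rw [chart, secSum, secSum, map_sum, Finset.mul_sum]
  refine Finset.sum_congr rfl fun i _ => ?_
  rw [map_smul, map_mul, map_apply_ιMulti, map_apply_ιMulti, ιMulti_zero_apply, one_mul,
    mul_smul_comm]
  rfl

/-- The forms `S.coord` are dual to the moved frame too and vanish on the complement, so contraction
recovers the second factor in `chart_eq`. -/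
lemma contractFrame_chart {s m : ℕ} (q : (Fin r → U) × SecParam s 0 m U) :
    map S.proj (contractFrame r S.coord (S.chart q)) = secSum q.2 := by
  rw [chart_eq, contractFrame_ιMulti_mul _ _ (fun i j => S.coord_chart i j _)]
  · rw [← AlgHom.comp_apply, map_comp_map, show S.proj ∘ₗ S.incl = LinearMap.id from
      LinearMap.ext S.proj_incl, map_id, AlgHom.id_apply]
  · intro i
    rw [secSum, map_sum, map_sum]
    refine Finset.sum_eq_zero fun l _ => ?_
    rw [ιMulti_zero_apply, one_mul, map_smul, map_apply_ιMulti, map_smul,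
      contract_ιMulti_eq_zero (S.coord i) (S.incl ∘ _) (fun _ => S.coord_incl _ _), smul_zero]

/-- With an invertible coordinate matrix, the common factors can be normalized without changing
their span. The resulting scalar is absorbed into the coefficients. -/
lemma exists_chart_eq {s m : ℕ} (p : SecParam s r m V)
    (hp : (Matrix.of fun i j => S.coord i (p.2.1 j)).det ≠ 0) :
    ∃ q : (Fin r → U) × SecParam s 0 m U, S.chart q = secSum p := by
  set G := Matrix.of fun i j => S.coord i (p.2.1 j) with hG
  have hunit : IsUnit G.det := isUnit_iff_ne_zero.2 hp
  let e' : Fin r → V := fun j => ∑ i, G⁻¹ i j • p.2.1 i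
  have hcoord : ∀ i j, S.coord i (e' j) = if i = j then 1 else 0 := fun i j => by
    have := congrFun (congrFun (Matrix.mul_nonsing_inv G hunit) i) j
    rw [Matrix.mul_apply, Matrix.one_apply] at this
    simpa [e', hG, mul_comm] using this
  have hmem : ∀ i, p.2.1 i ∈ Submodule.span ℂ (Set.range e') := fun i => by
    have : p.2.1 i = ∑ j, G j i • e' j := by
      have h1 : ∀ k, ∑ j, G⁻¹ k j * G j i = if k = i then 1 else 0 := fun k => by
        rw [← Matrix.mul_apply, Matrix.nonsing_inv_mul G hunit, Matrix.one_apply]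
      simp_rw [e', Finset.smul_sum, smul_smul]
      rw [Finset.sum_comm]
      simp_rw [← Finset.sum_smul, mul_comm (G _ i), h1]
      simp
    rw [this]
    exact Submodule.sum_mem _ fun j _ => Submodule.smul_mem _ _ (Submodule.subset_span ⟨j, rfl⟩)
  have hli : LinearIndependent ℂ e' := by
    rw [Fintype.linearIndependent_iff]
    intro g hg i
    simpa [hcoord] using congrArg (S.coord i) hg
  obtain ⟨c, hc⟩ := exists_ιMulti_eq_smul hli hmem
  -- Correcting by multiples of `e'` moves each further factor into the complement without changing
  -- the sum.
  let f' : Fin s → Fin m → U := fun i l =>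
    S.proj (p.2.2 i l - ∑ j, S.coord j (p.2.2 i l) • e' j)
  refine ⟨(fun j => S.proj (e' j - e j), fun i => p.1 i * c, 0, f'), ?_⟩
  have h1 : (fun j => e j + S.incl (S.proj (e' j - e j))) = e' := by
    ext j
    rw [S.incl_proj_of_coord_eq_zero fun i => by rw [map_sub, hcoord, S.coord_frame, sub_self],
      add_sub_cancel]
  have h2 : secSum p = secSum (fun i => p.1 i * c, e', p.2.2) :=
    Finset.sum_congr rfl fun i _ => by rw [hc, smul_mul_assoc, smul_smul]
  rw [h2, chart, chartParam]
  simp only [h1]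
  refine secSum_congr _ _ _ _ fun i l => ?_
  rw [S.incl_proj_of_coord_eq_zero fun j => by simp [hcoord], sub_sub_cancel_left]
  exact neg_mem (Submodule.sum_mem _ fun j _ => Submodule.smul_mem _ _
    (Submodule.subset_span ⟨j, rfl⟩))

lemma imageDim_chart [FiniteDimensional ℂ V] (s m : ℕ) :
    imageDim (S.chart : (Fin r → U) × SecParam s 0 m U → ExteriorAlgebra ℂ V) =
      imageDim (secSum : SecParam s r m V → ExteriorAlgebra ℂ V) := by
  refine imageDim_comp_of_dense secSum S.chartParam fun F hF h => ?_
  have h1 := comp_mem_polyFun (isPolyMap_secSum (V := V) s r m) hF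
  have h2 := det_mem_subalgebra (polyFun (SecParam s r m V)) (fun i j p => S.coord i (p.2.1 j))
    fun i j => dual_mem_polyFun (S.coord i ∘ₗ (LinearMap.proj j : (Fin r → V) →ₗ[ℂ] V) ∘ₗ
      LinearMap.fst ℂ (Fin r → V) (Fin s → Fin m → V) ∘ₗ LinearMap.snd ℂ (Fin s → ℂ) _)
  -- The product with the determinant vanishes everywhere: off the zeros of the determinant the
  -- chart covers the value. The determinant is 1 at `e`, so it can be cancelled.
  have h3 := eq_zero_or_eq_zero_of_mem_polyFun h1 h2 <| funext fun p => by
    by_cases hp : (Matrix.of fun i j => S.coord i (p.2.1 j)).det = 0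
    · simp [hp]
    · obtain ⟨q, hq⟩ := S.exists_chart_eq p hp
      have := h q
      rw [← chart, hq] at this
      simp [this]
  refine fun p => congrFun (h3.resolve_right fun h0 => ?_) p
  have h4 := congrFun h0 (0, e, 0)
  have h5 : (Matrix.of fun i j => S.coord i (e j)) = 1 := by
    ext i j
    rw [Matrix.of_apply, S.coord_frame, Matrix.one_apply]
  simp [h5] at h4

/-- The coordinate functions of the affine chart of the Grassmannian. -/
def chartCoord (r : ℕ) {κ : Type*} (b : Module.Basis κ ℂ U) (P : Type*) (x : Fin r × κ) :
    (Fin r → U) × P → ℂ :=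
  fun q => b.coord x.2 (q.1 x.1)

/-- Elements of the coefficient ring do not depend on the chart coordinates. For each fixed `p`, a
relation is a complex polynomial vanishing at every point, so all its coefficients vanish at `p`. -/
lemma algebraicIndependent_chartCoord {κ P W : Type*} [Finite κ] [AddCommGroup W] [Module ℂ W]
    (b : Module.Basis κ ℂ U) (Φ : P → W) :
    AlgebraicIndependent (pullbackRing (fun q : (Fin r → U) × P => Φ q.2))
      (chartCoord r b P) := by
  have := Fintype.ofFinite κ
  set C := pullbackRing (fun q : (Fin r → U) × P => Φ q.2)
  have hC : ∀ (c : C) (a a' : Fin r → U) (p : P), c.1 (a, p) = c.1 (a', p) := by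
    rintro ⟨_, F, hF, rfl⟩ a a' p
    rfl
  rw [algebraicIndependent_iff]
  intro f hf
  let ev : P → C →+* ℂ := fun p => (Pi.evalRingHom (fun _ => ℂ) ((0 : Fin r → U), p)).comp
    C.val.toRingHom
  have hev : ∀ p, MvPolynomial.map (ev p) f = 0 := by
    intro p
    refine MvPolynomial.funext fun a => ?_
    let A : Fin r → U := fun j => ∑ l, a (j, l) • b l
    have hA : ∀ x, chartCoord r b P x (A, p) = a x := fun x => by
      classical
      simp [chartCoord, A, Finsupp.single_apply]
    have h := congrFun hf (A, p)
    rw [MvPolynomial.aeval_def] at h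
    have h2 : MvPolynomial.eval₂ (algebraMap C ((Fin r → U) × P → ℂ)) (chartCoord r b P) f (A, p) =
        MvPolynomial.eval₂ (ev p) a f := by
      refine (MvPolynomial.hom_eval₂ f _ (Pi.evalRingHom (fun _ => ℂ) (A, p)) _).trans ?_
      congr 1
      · ext c
        exact hC c _ _ _
      · ext x
        exact hA x
    rw [h2] at h
    rw [MvPolynomial.eval_map, h]
    simp
  ext μ q
  have := congrArg (MvPolynomial.coeff μ) (hev q.2)
  rw [MvPolynomial.coeff_map, MvPolynomial.coeff_zero] at this
  rw [MvPolynomial.coeff_zero]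
  exact (hC _ q.1 0 q.2).trans this

variable {s m : ℕ}

lemma pullbackRing_secSum_le_chart :
    pullbackRing (fun q : (Fin r → U) × SecParam s 0 m U => secSum q.2) ≤
      pullbackRing (S.chart : (Fin r → U) × SecParam s 0 m U → _) := by
  refine pullbackRing_le fun φ => ?_
  convert dual_mem_pullbackRing (S.chart : (Fin r → U) × SecParam s 0 m U → _)
    (φ ∘ₗ (map S.proj).toLinearMap ∘ₗ contractFrame r S.coord) using 2 with q
  exact congrArg φ (S.contractFrame_chart q).symm

lemma pullbackRing_chart_le [FiniteDimensional ℂ V] {κ : Type*} [Finite κ]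
    (b : Module.Basis κ ℂ U) :
    pullbackRing (S.chart : (Fin r → U) × SecParam s 0 m U → _) ≤
      pullbackRing (fun q : (Fin r → U) × SecParam s 0 m U => secSum q.2) ⊔
        adjoin ℂ (Set.range (chartCoord r b (SecParam s 0 m U))) := by
  have := Fintype.ofFinite κ
  refine pullbackRing_le fun φ => ?_
  set A := pullbackRing (fun q : (Fin r → U) × SecParam s 0 m U => secSum q.2) ⊔
        adjoin ℂ (Set.range (chartCoord r b (SecParam s 0 m U))) with hA
  let v := Module.finBasis ℂ V
  -- Multilinear in the moved frame, with values in the linear forms on the exterior algebra of `U`;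
  -- expanding it in a basis of `V` separates chart coordinates from pullbacks.
  let G : MultilinearMap ℂ (fun _ : Fin r => V) (ExteriorAlgebra ℂ U →ₗ[ℂ] ℂ) :=
    (((LinearMap.mul ℂ (ExteriorAlgebra ℂ V)).compr₂ φ).compl₂
      (map S.incl).toLinearMap).compMultilinearMap (wedge r).toMultilinearMap
  have hG : ∀ q : (Fin r → U) × SecParam s 0 m U,
      φ (S.chart q) = G (fun j => e j + S.incl (q.1 j)) (secSum q.2) := fun q => by
    rw [chart_eq]
    rfl
  have hcoord : ∀ (β : Module.Dual ℂ V) (j : Fin r),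
      (fun q : (Fin r → U) × SecParam s 0 m U => β (e j + S.incl (q.1 j))) ∈ A := by
    intro β j
    have : (fun q : (Fin r → U) × SecParam s 0 m U => β (e j + S.incl (q.1 j))) =
        algebraMap ℂ _ (β (e j)) +
          ∑ l, β (S.incl (b l)) • chartCoord r b (SecParam s 0 m U) (j, l) := by
      ext q
      simp only [Pi.add_apply, Finset.sum_apply, Pi.smul_apply, chartCoord, map_add,
        Pi.algebraMap_apply, Algebra.algebraMap_self, RingHom.id_apply]
      conv_lhs => rw [← b.sum_repr (q.1 j)]
      simp only [map_sum, map_smul, smul_eq_mul, mul_comm, b.coord_apply]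
    rw [this]
    refine add_mem (Subalgebra.algebraMap_mem _ _) (Subalgebra.sum_mem _ fun l _ =>
      Subalgebra.smul_mem _ ((le_sup_right : _ ≤ A) (subset_adjoin ⟨(j, l), rfl⟩)) _)
  have : (fun q => φ (S.chart q)) = ∑ J : Fin r → Fin (Module.finrank ℂ V),
      (∏ j, fun q : (Fin r → U) × SecParam s 0 m U => v.coord (J j) (e j + S.incl (q.1 j))) *
        fun q : (Fin r → U) × SecParam s 0 m U => G (fun j => v (J j)) (secSum q.2) := by
    ext q
    rw [hG, multilinear_expand v G, LinearMap.sum_apply, Finset.sum_apply]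
    refine Finset.sum_congr rfl fun J _ => ?_
    rw [LinearMap.smul_apply, Pi.mul_apply, Finset.prod_apply, smul_eq_mul]
  rw [this]
  exact Subalgebra.sum_mem _ fun J _ => mul_mem (Subalgebra.prod_mem _ fun j _ => hcoord _ _)
    ((le_sup_left : _ ≤ A) (dual_mem_pullbackRing _ _))

/-- Where the annihilator of a point of the chart is spanned by the frame, the chart coordinates are
rational functions of the point, by Cramer's rule. -/
lemma exists_mul_chartCoord_mem {κ : Type*} [Finite κ] (b : Module.Basis κ ℂ U)
    (q₀ : (Fin r → U) × SecParam s 0 m U)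
    (h₀ : ∀ v, ι ℂ v * S.chart q₀ = 0 → v ∈ Submodule.span ℂ (Set.range e)) (x : Fin r × κ) :
    ∃ f ∈ pullbackRing (S.chart : (Fin r → U) × SecParam s 0 m U → _), f ≠ 0 ∧
      f * chartCoord r b (SecParam s 0 m U) x ∈
        pullbackRing (S.chart : (Fin r → U) × SecParam s 0 m U → _) := by
  classical
  have := Fintype.ofFinite κ
  set B := pullbackRing (S.chart : (Fin r → U) × SecParam s 0 m U → _)
  let M : U →ₗ[ℂ] ExteriorAlgebra ℂ V := LinearMap.mulRight ℂ (S.chart q₀) ∘ₗ ι ℂ ∘ₗ S.incl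
  have hM : LinearMap.ker M = ⊥ := by
    rw [LinearMap.ker_eq_bot']
    intro u hu
    rw [← S.proj_incl u]
    exact S.proj_of_mem_span (h₀ _ hu)
  -- Composing with `π` turns the overdetermined system v ∧ ω = 0 into a square one that is
  -- nonsingular at `q₀`.
  obtain ⟨π, hπ⟩ := LinearMap.exists_leftInverse_of_injective M hM
  let form : κ → V → Module.Dual ℂ (ExteriorAlgebra ℂ V) := fun i v =>
    b.coord i ∘ₗ π ∘ₗ LinearMap.mulLeft ℂ (ι ℂ v)
  have hform : ∀ i v, (fun q => form i v (S.chart q)) ∈ B := fun i v => dual_mem_pullbackRing _ _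
  let N : Matrix κ κ B := Matrix.of fun i l => ⟨_, hform i (S.incl (b l))⟩
  let c : κ → B := fun i => -⟨_, hform i (e x.1)⟩
  let val : B →+* ((Fin r → U) × SecParam s 0 m U → ℂ) := B.val.toRingHom
  let ev : ((Fin r → U) × SecParam s 0 m U) → B →+* ℂ := fun q =>
    (Pi.evalRingHom (fun _ => ℂ) q).comp val
  have hsys : ∀ q i, ∑ l, ev q (N i l) * chartCoord r b (SecParam s 0 m U) (x.1, l) q =
      ev q (c i) := by
    intro q i
    -- The moved frame vector annihilates the point: a linear system for its own coordinates.
    have h1 : ι ℂ (e x.1 + S.incl (q.1 x.1)) * S.chart q = 0 :=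
      ι_mul_secSum_of_mem_span _ (Submodule.subset_span ⟨x.1, rfl⟩)
    have h2 : form i (e x.1) (S.chart q) +
        ∑ l, form i (S.incl (b l)) (S.chart q) * b.coord l (q.1 x.1) = 0 := by
      have h3 : b.coord i (π (ι ℂ (e x.1 + S.incl (q.1 x.1)) * S.chart q)) = 0 := by
        rw [h1, map_zero, map_zero]
      rw [← h3]
      conv_rhs => rw [← b.sum_repr (q.1 x.1)]
      simp only [map_add, map_sum, add_mul, Finset.sum_mul, map_smul, smul_mul_assoc]
      congr 1
      exact Finset.sum_congr rfl fun l _ => mul_comm _ _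
    exact eq_neg_of_add_eq_zero_right h2
  refine ⟨N.det, N.det.2, fun h => ?_, ?_⟩
  · have h1 : ev q₀ N.det = 0 := congrFun h q₀
    rw [RingHom.map_det] at h1
    have h2 : (ev q₀).mapMatrix N = 1 := by
      ext i l
      have := LinearMap.congr_fun hπ (b l)
      change b.coord i (π (M (b l))) = _
      rw [← LinearMap.comp_apply π M, this, LinearMap.id_apply, b.coord_apply, b.repr_self,
        Finsupp.single_apply, Matrix.one_apply]
      simp [eq_comm]
    simp [h2] at h1
  · have h1 : (N.det : (Fin r → U) × SecParam s 0 m U → ℂ) *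
        chartCoord r b (SecParam s 0 m U) x = (N.adjugate.mulVec c x.2 : B) := by
      ext q
      let N' := (ev q).mapMatrix N
      let y : κ → ℂ := fun l => chartCoord r b (SecParam s 0 m U) (x.1, l) q
      have h2 : N'.mulVec y = fun i => ev q (c i) := funext fun i => hsys q i
      have h3 : N'.det * y x.2 = N'.adjugate.mulVec (fun i => ev q (c i)) x.2 := by
        rw [← h2, Matrix.mulVec_mulVec, Matrix.adjugate_mul, Matrix.smul_mulVec, Matrix.one_mulVec]
        rfl
      have h4 : ev q (N.adjugate.mulVec c x.2) = N'.adjugate.mulVec (fun i => ev q (c i)) x.2 := by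
        rw [RingHom.map_mulVec, ← RingHom.map_adjugate]
        rfl
      have h5 : ev q N.det = N'.det := RingHom.map_det _ _
      calc _ = ev q N.det * y x.2 := rfl
        _ = ev q (N.adjugate.mulVec c x.2) := by rw [h5, h3, h4]
    rw [h1]
    exact Subtype.prop _

/-- The dimension of the family of sums with common factors, if the common factors of a general
member are determined by it. -/
theorem imageDim_secSum (S : Splitting e U) [FiniteDimensional ℂ V] [FiniteDimensional ℂ U]
    (s m : ℕ)
    (h : r = 0 ∨ ∃ (c : Fin s → ℂ) (f : Fin s → Fin m → V),
      ∀ v, ι ℂ v * secSum (c, e, f) = 0 → v ∈ Submodule.span ℂ (Set.range e)) :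
    imageDim (secSum : SecParam s r m V → ExteriorAlgebra ℂ V) =
      r * Module.finrank ℂ U + imageDim (secSum : SecParam s 0 m U → ExteriorAlgebra ℂ U) := by
  let b := Module.finBasis ℂ U
  set Q := (Fin r → U) × SecParam s 0 m U
  set C := pullbackRing (fun q : Q => secSum q.2)
  have hpoly : C ⊔ adjoin ℂ (Set.range (chartCoord r b (SecParam s 0 m U))) ≤ polyFun Q := by
    refine sup_le (pullbackRing_le_polyFun ?_) (adjoin_le ?_)
    · exact (isPolyMap_secSum s 0 m).comp_linear (LinearMap.snd ℂ (Fin r → U) (SecParam s 0 m U))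
    · rintro _ ⟨x, rfl⟩
      exact dual_mem_polyFun (b.coord x.2 ∘ₗ (LinearMap.proj x.1 : (Fin r → U) →ₗ[ℂ] U) ∘ₗ
        LinearMap.fst ℂ (Fin r → U) (SecParam s 0 m U))
  have key := trdeg_eq_trdeg_add_card (pullbackRing (S.chart : Q → _)) C
    (chartCoord r b (SecParam s 0 m U)) (noZeroDivisors_of_le_polyFun hpoly)
    S.pullbackRing_secSum_le_chart (S.pullbackRing_chart_le b)
    (algebraicIndependent_chartCoord b secSum) (fun x => by
      rcases h with h0 | ⟨c, f, hcf⟩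
      · exact (Fin.cast h0 x.1).elim0
      -- The general member lies in the chart at the undisplaced frame, its further factors
      -- projected to the complement.
      · refine S.exists_mul_chartCoord_mem b (0, c, 0, fun i l => S.proj (f i l)) (fun v hv => ?_) x
        refine hcf v ?_
        rw [← hv]
        congr 1
        simp only [chart, chartParam, Pi.zero_apply, map_zero, add_zero]
        refine secSum_congr _ _ _ _ fun i l => ?_
        nth_rewrite 1 [← S.sum_eq (f i l)]
        rw [add_sub_cancel_right]
        exact Submodule.sum_mem _ fun j _ => Submodule.smul_mem _ _
          (Submodule.subset_span ⟨j, rfl⟩))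
  have : FiniteType ℂ C := finiteType_pullbackRing _
  have hfin : trdeg ℂ C < Cardinal.aleph0 := trdeg_lt_aleph0_of_finiteType
  rw [← S.imageDim_chart, imageDim, key, Cardinal.toNat_add hfin (Cardinal.natCast_lt_aleph0),
    ← imageDim_comp_surjective (g := (Prod.snd : Q → SecParam s 0 m U)) secSum
      Prod.snd_surjective, imageDim, add_comm,
    Cardinal.toNat_natCast, Nat.card_prod, Nat.card_fin, Nat.card_fin]

end Splitting

/-! ### Cones over secant sets as images of sums -/

section Cones

variable {V : Type*} [AddCommGroup V] [Module ℂ V]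

/-- The points `[c₁ Ê₁ + ⋯ + c_s Ê_s]` with `dim (E₁ ∩ ⋯ ∩ E_s) ≥ r`. -/
def restrictedSet (s r k : ℕ) (V : Type*) [AddCommGroup V] [Module ℂ V] :
    Set (Projectivization ℂ (⋀[ℂ]^k V)) :=
  {p | ∃ (E : Fin s → Submodule ℂ V) (x : Fin s → ⋀[ℂ]^k V) (c : Fin s → ℂ)
    (h : ∑ i, c i • x i ≠ 0), (∀ i, IsPluckerRep k (E i) (x i)) ∧
      r ≤ Module.finrank ℂ (⨅ i, E i : Submodule ℂ V) ∧ p = Projectivization.mk ℂ _ h}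

lemma restrictedSecant_eq (s r k : ℕ) :
    restrictedSecant s r k V = zariskiClosure (restrictedSet s r k V) := rfl

lemma restrictedSet_antitone (s k : ℕ) {r r' : ℕ} (h : r ≤ r') :
    restrictedSet s r' k V ⊆ restrictedSet s r k V := by
  rintro p ⟨E, x, c, h0, hx, hr, rfl⟩
  exact ⟨E, x, c, h0, hx, h.trans hr, rfl⟩

lemma mem_iff_rep_mem_affineCone {W : Type*} [AddCommGroup W] [Module ℂ W]
    (X : Set (Projectivization ℂ W)) (p : Projectivization ℂ W) :
    p ∈ X ↔ p.rep ∈ affineCone X :=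
  ⟨rep_mem_affineCone, fun h => by simpa using h p.rep_nonzero⟩

lemma IsPluckerRep.finrank_eq {k : ℕ} {E : Submodule ℂ V} {x : ⋀[ℂ]^k V}
    (h : IsPluckerRep k E x) : Module.finrank ℂ E = k := by
  obtain ⟨e, he, rfl, -⟩ := h
  rw [finrank_span_eq_card he, Fintype.card_fin]

lemma linearIndependent_of_secSum_ne_zero {s r m : ℕ} {p : SecParam s r m V} (h : secSum p ≠ 0) :
    LinearIndependent ℂ p.2.1 := by
  refine linearIndependent_of_ιMulti_ne_zero fun h0 => h ?_
  simp [secSum, h0]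

lemma exists_dual_eq_one {r : ℕ} {e : Fin r → V} {v : V}
    (hv : v ∉ Submodule.span ℂ (Set.range e)) :
    ∃ d : Module.Dual ℂ V, d v = 1 ∧ ∀ i, d (e i) = 0 := by
  obtain ⟨d, hd, hker⟩ := Submodule.exists_le_ker_of_notMem hv
  refine ⟨(d v)⁻¹ • d, by simp [hd], fun i => ?_⟩
  have : d (e i) = 0 := hker (Submodule.subset_span ⟨i, rfl⟩)
  simp [this]

/-- A sum of decomposable vectors with common factors `e` that is divisible by a further vector can
be rewritten as a sum in which that vector is a common factor as well. -/
lemma exists_secSum_succ {s r m : ℕ} (p : SecParam s r m V) (hp : secSum p ≠ 0) {v : V}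
    (hv : v ∉ Submodule.span ℂ (Set.range p.2.1)) (hvp : ι ℂ v * secSum p = 0) :
    ∃ m', m = m' + 1 ∧ ∃ p' : SecParam s (r + 1) m' V, secSum p' = secSum p := by
  obtain ⟨d, hdv, hde⟩ := exists_dual_eq_one hv
  -- Contraction of v ∧ ω = 0 with `d`, where d(v) = 1.
  have h1 : secSum p = ι ℂ v * contract d (secSum p) := by
    have := contract_ι_mul d v (secSum p)
    rw [hvp, map_zero, hdv, one_smul] at this
    exact (sub_eq_zero.1 this.symm)
  have h2 : contract d (secSum p) =
      ∑ i, (p.1 i * (-1) ^ r) • (wedge r p.2.1 * contract d (wedge m (p.2.2 i))) := by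
    rw [secSum, map_sum]
    exact Finset.sum_congr rfl fun i _ => by
      rw [map_smul, contract_ιMulti_mul d _ hde, smul_smul]
  cases m with
  | zero =>
    -- Without further factors the contraction vanishes, forcing ω = 0.
    refine absurd (h1.trans ?_) hp
    rw [h2]
    simp [contract_one]
  | succ m' =>
    refine ⟨m', rfl, ?_⟩
    choose a f haf using fun i => exists_contract_ιMulti_eq d (p.2.2 i)
    refine ⟨(fun i => p.1 i * (-1) ^ r * a i, Matrix.vecCons v p.2.1, f), ?_⟩
    rw [h1, h2, secSum, Finset.mul_sum]
    refine Finset.sum_congr rfl fun i _ => ?_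
    rw [haf, ιMulti_succ_apply, mul_smul_comm, mul_smul_comm, mul_smul_comm, smul_smul, mul_assoc]
    simp

variable [FiniteDimensional ℂ V]

lemma ιMulti_ne_zero {k : ℕ} {e : Fin k → V} (he : LinearIndependent ℂ e) : wedge k e ≠ 0 := by
  have hk : k ≤ Module.finrank ℂ V := by simpa using he.fintype_card_le_finrank
  obtain ⟨S⟩ := nonempty_splitting he (Fin (Module.finrank ℂ V - k) → ℂ) (by simp; lia)
  intro h
  have := contractFrame_ιMulti_mul S.coord e S.coord_frame 1 fun i => contract_one _
  rw [mul_one, h, map_zero] at this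
  exact zero_ne_one this

lemma IsPluckerRep.ne_zero {k : ℕ} {E : Submodule ℂ V} {x : ⋀[ℂ]^k V} (h : IsPluckerRep k E x) :
    x ≠ 0 := by
  obtain ⟨e, he, -, rfl⟩ := h
  exact fun h0 => ιMulti_ne_zero he (congrArg Subtype.val h0)

lemma IsPluckerRep.exists_eq_smul {r m : ℕ} {E : Submodule ℂ V} {x : ⋀[ℂ]^(r + m) V}
    (h : IsPluckerRep (r + m) E x) {e : Fin r → V} (he : LinearIndependent ℂ e)
    (heE : ∀ i, e i ∈ E) :
    ∃ (a : ℂ) (f : Fin m → V), (x : ExteriorAlgebra ℂ V) = a • (wedge r e * wedge m f) := by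
  obtain ⟨f, hf, hspan⟩ := exists_append_basis he E heE h.finrank_eq
  obtain ⟨b, -, hb, rfl⟩ := h
  obtain ⟨a, ha⟩ := exists_ιMulti_eq_smul hf (e' := b) fun i => by
    rw [hspan, ← hb]
    exact Submodule.subset_span ⟨i, rfl⟩
  exact ⟨a, f, by rw [ιMulti_mul_ιMulti, ← ha]; rfl⟩

lemma exists_linearIndependent_of_le_finrank {r : ℕ} (E : Submodule ℂ V)
    (h : r ≤ Module.finrank ℂ E) : ∃ e : Fin r → V, LinearIndependent ℂ e ∧ ∀ i, e i ∈ E :=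
  ⟨fun i => Module.finBasis ℂ E (Fin.castLE h i),
    ((Module.finBasis ℂ E).linearIndependent.map' E.subtype E.ker_subtype).comp _
      (Fin.castLE_injective h), fun _ => Subtype.prop _⟩

/-- A vanishing product must still be assigned a genuine plane containing the frame; its coefficient
is then 0, and `hk` provides room for the plane. -/
lemma exists_isPluckerRep {r m : ℕ} {e : Fin r → V} (he : LinearIndependent ℂ e)
    (hk : r + m ≤ Module.finrank ℂ V) (f : Fin m → V) :
    ∃ (E : Submodule ℂ V) (x : ⋀[ℂ]^(r + m) V) (a : ℂ), IsPluckerRep (r + m) E x ∧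
      (∀ i, e i ∈ E) ∧ wedge r e * wedge m f = a • (x : ExteriorAlgebra ℂ V) := by
  have of_li : ∀ g : Fin m → V, LinearIndependent ℂ (Fin.append e g) →
      ∃ (E : Submodule ℂ V) (x : ⋀[ℂ]^(r + m) V), IsPluckerRep (r + m) E x ∧
        (∀ i, e i ∈ E) ∧ wedge r e * wedge m g = (x : ExteriorAlgebra ℂ V) := fun g hg =>
    ⟨Submodule.span ℂ (Set.range (Fin.append e g)), _, ⟨_, hg, rfl, rfl⟩,
      fun i => Submodule.subset_span ⟨Fin.castAdd m i, Fin.append_left e g i⟩,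
      ιMulti_mul_ιMulti e g⟩
  by_cases h0 : wedge r e * wedge m f = 0
  · obtain ⟨f', hf', -⟩ : ∃ f' : Fin (Module.finrank ℂ V - r) → V,
        LinearIndependent ℂ (Fin.append e f') ∧ _ :=
      exists_append_basis he ⊤ (fun _ => trivial) (by rw [finrank_top]; lia)
    have hm : m ≤ Module.finrank ℂ V - r := by lia
    have hli : LinearIndependent ℂ (Fin.append e fun i => f' (Fin.castLE hm i)) := by
      have hle : r + m ≤ r + (Module.finrank ℂ V - r) := by lia
      convert hf'.comp (Fin.castLE hle) (Fin.castLE_injective hle) using 1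
      ext i
      induction i using Fin.addCases with
      | left i => exact (Fin.append_left e _ i).trans (Fin.append_left e f' i).symm
      | right i =>
        exact (Fin.append_right e _ i).trans (Fin.append_right e f' (Fin.castLE hm i)).symm
    obtain ⟨E, x, hx, hE, -⟩ := of_li _ hli
    exact ⟨E, x, 0, hx, hE, by rw [h0, zero_smul]⟩
  · rw [ιMulti_mul_ιMulti] at h0
    obtain ⟨E, x, hx, hE, h⟩ := of_li f (linearIndependent_of_ιMulti_ne_zero h0)
    exact ⟨E, x, 1, hx, hE, by rw [h, one_smul]⟩

/-- The affine cone over the restricted secant set is the set of sums of decomposable vectors with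
`r` common factors. -/
lemma range_secSum {s r m k : ℕ} (hk : k = r + m) (hkn : k ≤ Module.finrank ℂ V) :
    Set.range (secSum : SecParam s r m V → ExteriorAlgebra ℂ V) =
      (⋀[ℂ]^k V).subtype '' affineCone (restrictedSet s r k V) := by
  subst hk
  apply Set.Subset.antisymm
  · rintro _ ⟨p, rfl⟩
    by_cases h0 : secSum p = 0
    · exact ⟨0, fun h => absurd rfl h, h0.symm⟩
    have he := linearIndependent_of_secSum_ne_zero h0
    choose E x a hx hE hxa using fun i => exists_isPluckerRep he hkn (p.2.2 i)
    have hsum : ((∑ i, (p.1 i * a i) • x i : ⋀[ℂ]^(r + m) V) : ExteriorAlgebra ℂ V) =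
        secSum p := by
      simp [secSum, hxa, smul_smul]
    refine ⟨_, fun h => ⟨E, x, _, h, hx, ?_, rfl⟩, hsum⟩
    have hle : Submodule.span ℂ (Set.range p.2.1) ≤ ⨅ i, E i := by
      rw [Submodule.span_le]
      rintro _ ⟨j, rfl⟩
      simp [hE]
    simpa [finrank_span_eq_card he] using Submodule.finrank_mono hle
  · rintro _ ⟨v, hv, rfl⟩
    by_cases h0 : v = 0
    · exact ⟨0, by simp [h0, secSum]⟩
    obtain ⟨E, x, c, hne, hx, hr, hmk⟩ := hv h0
    obtain ⟨t, ht⟩ := (Projectivization.mk_eq_mk_iff' ..).1 hmk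
    obtain ⟨e, he, heE⟩ := exists_linearIndependent_of_le_finrank _ hr
    choose a f haf using fun i => (hx i).exists_eq_smul he fun j => by
      simpa using (Submodule.mem_iInf _).1 (heE j) i
    refine ⟨(fun i => t * (c i * a i), e, f), ?_⟩
    rw [← ht]
    simp [secSum, haf, smul_smul, Finset.smul_sum, mul_assoc]

lemma projDim_restrictedSecant {s r m k : ℕ} (hk : k = r + m) (hkn : k ≤ Module.finrank ℂ V) :
    projDim (restrictedSecant s r k V) =
      (imageDim (secSum : SecParam s r m V → ExteriorAlgebra ℂ V) : ℤ) - 1 := by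
  rw [restrictedSecant_eq, projDim_zariskiClosure]
  exact projDim_eq_imageDim_of_range_eq _ _ (Submodule.subtype_injective _) _
    (range_secSum hk hkn)

/-- Representatives of points differ from Plücker vectors by scalars, which the coefficients absorb;
the condition on the intersection is empty for r = 0. -/
lemma secantVariety_grassmannian (s k : ℕ) :
    secantVariety s (grassmannian k V) = restrictedSecant s 0 k V := by
  rw [secantVariety, restrictedSecant_eq]
  congr 1
  ext p
  constructor
  · rintro ⟨x, hx, hp⟩
    choose E y hy hrep hxy using hx
    obtain ⟨a, ha⟩ := (Submodule.mem_span_range_iff_exists_fun ℂ).1 hp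
    have hu : ∀ i, ∃ u : ℂ, u • y i = (x i).rep := fun i => by
      obtain ⟨u, hu⟩ := Projectivization.exists_smul_eq_mk_rep ℂ (y i) (hy i)
      exact ⟨u, by rw [hxy i, ← hu]; rfl⟩
    choose u hu using hu
    have hsum : ∑ i, (a i * u i) • y i = p.rep := by
      rw [← ha]
      exact Finset.sum_congr rfl fun i _ => by rw [← hu, smul_smul]
    refine ⟨E, y, fun i => a i * u i, hsum ▸ p.rep_nonzero, hrep, Nat.zero_le _, ?_⟩
    simp_rw [hsum, Projectivization.mk_rep]
  · rintro ⟨E, x, c, h, hx, -, rfl⟩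
    refine ⟨fun i => Projectivization.mk ℂ (x i) (hx i).ne_zero,
      fun i => ⟨E i, x i, (hx i).ne_zero, hx i, rfl⟩, ?_⟩
    obtain ⟨t, ht⟩ := Projectivization.exists_smul_eq_mk_rep ℂ _ h
    rw [← ht]
    refine Submodule.smul_mem _ (t : ℂ) (Submodule.sum_mem _ fun i _ => Submodule.smul_mem _ _ ?_)
    obtain ⟨u, hu⟩ := Projectivization.exists_smul_eq_mk_rep ℂ (x i) (hx i).ne_zero
    have : x i = (u⁻¹ : ℂˣ) • (Projectivization.mk ℂ (x i) (hx i).ne_zero).rep := by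
      rw [← hu, inv_smul_smul]
    rw [this]
    exact Submodule.smul_mem _ ((u⁻¹ : ℂˣ) : ℂ) (Submodule.subset_span ⟨i, rfl⟩)

lemma grassmannian_eq_restrictedSet (r : ℕ) : grassmannian r V = restrictedSet 1 r r V := by
  ext p
  constructor
  · rintro ⟨E, x, hx, hrep, rfl⟩
    refine ⟨fun _ => E, fun _ => x, fun _ => 1, by simpa using hx, fun _ => hrep, ?_, by simp⟩
    rw [iInf_const, hrep.finrank_eq]
  · rintro ⟨E, x, c, h, hx, -, rfl⟩
    refine ⟨E 0, x 0, (hx 0).ne_zero, hx 0, ?_⟩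
    exact (Projectivization.mk_eq_mk_iff' ..).2 ⟨c 0, by simp⟩

end Cones

/-! ### Maximal overlaps -/

section Overlap

variable {V : Type*} [AddCommGroup V] [Module ℂ V] [FiniteDimensional ℂ V]

lemma exists_general_secSum {s r m k : ℕ} (hk : k = r + m) (hkn : k ≤ Module.finrank ℂ V)
    (h : restrictedSecant s (r + 1) k V ≠ restrictedSecant s r k V) :
    ∃ p : SecParam s r m V, secSum p ≠ 0 ∧
      ∀ v, ι ℂ v * secSum p = 0 → v ∈ Submodule.span ℂ (Set.range p.2.1) := by
  by_contra! hcon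
  refine h (congrArg zariskiClosure (Set.Subset.antisymm
    (restrictedSet_antitone s k (Nat.le_succ r)) fun p hp => ?_))
  rw [mem_iff_rep_mem_affineCone] at hp ⊢
  obtain ⟨q, hq⟩ : (⋀[ℂ]^k V).subtype p.rep ∈ Set.range (secSum : SecParam s r m V → _) :=
    range_secSum hk hkn ▸ Set.mem_image_of_mem _ hp
  have hq0 : secSum q ≠ 0 := by
    rw [hq]
    exact fun h0 => p.rep_nonzero (Subtype.ext h0)
  obtain ⟨v, hv, hvq⟩ := hcon q hq0
  obtain ⟨m', rfl, q', hq'⟩ := exists_secSum_succ q hq0 hvq hv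
  have : (⋀[ℂ]^k V).subtype p.rep ∈ Set.range (secSum : SecParam s (r + 1) m' V → _) :=
    ⟨q', hq'.trans hq⟩
  rw [range_secSum (k := k) (by lia) hkn] at this
  obtain ⟨w, hw, hwp⟩ := this
  rwa [← Submodule.subtype_injective _ hwp]

lemma zariskiClosure_empty {W : Type*} [AddCommGroup W] [Module ℂ W] :
    zariskiClosure (∅ : Set (Projectivization ℂ W)) = ∅ := by
  ext p
  simp only [Set.mem_empty_iff_false, iff_false]
  intro hp
  exact one_ne_zero (hp 0 1 ⟨one_mem _, fun c v => by simp⟩ (by simp))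

/-- As s ≥ 1, the intersection lies in a `k`-plane, so overlap k + 1 gives the empty set, while
overlap `k` is attained by equal planes. This starts the descending induction in
`exists_maximal_overlap`. -/
lemma restrictedSecant_succ_self_ne {s k : ℕ} (hs : 1 ≤ s) (hkn : k ≤ Module.finrank ℂ V) :
    restrictedSecant s (k + 1) k V ≠ restrictedSecant s k k V := by
  have hempty : restrictedSet s (k + 1) k V = ∅ := by
    rw [Set.eq_empty_iff_forall_notMem]
    rintro p ⟨E, x, c, h, hx, hr, -⟩
    have := Submodule.finrank_mono (iInf_le E ⟨0, hs⟩)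
    rw [(hx _).finrank_eq] at this
    lia
  obtain ⟨e, he, -⟩ := exists_linearIndependent_of_le_finrank (V := V) (r := k) ⊤
    (by rwa [finrank_top])
  obtain ⟨E, x, a, hx, -, -⟩ := exists_isPluckerRep (m := 0) he hkn Fin.elim0
  have hsum : ∑ i : Fin s, (if i = ⟨0, hs⟩ then (1 : ℂ) else 0) • x = x := by simp
  have hmem : Projectivization.mk ℂ x hx.ne_zero ∈ restrictedSecant s k k V :=
    subset_zariskiClosure _ ⟨fun _ => E, fun _ => x, fun i => if i = ⟨0, hs⟩ then 1 else 0,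
      by rw [hsum]; exact hx.ne_zero, fun _ => hx, by
        have : Nonempty (Fin s) := ⟨⟨0, hs⟩⟩
        rw [iInf_const]
        exact hx.finrank_eq.ge, by simp only [hsum]⟩
  intro h
  rw [← h, restrictedSecant_eq, hempty, zariskiClosure_empty] at hmem
  exact hmem

lemma exists_maximal_overlap {s k : ℕ} (hs : 1 ≤ s) (hkn : k ≤ Module.finrank ℂ V) {r : ℕ}
    (hrk : r ≤ k) : ∃ q, r ≤ q ∧ q ≤ k ∧ restrictedSecant s q k V = restrictedSecant s r k V ∧
      restrictedSecant s (q + 1) k V ≠ restrictedSecant s q k V := by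
  induction hrk using Nat.decreasingInduction with
  | self => exact ⟨k, le_rfl, le_rfl, rfl, restrictedSecant_succ_self_ne hs hkn⟩
  | of_succ r hr ih =>
    by_cases h : restrictedSecant s (r + 1) k V = restrictedSecant s r k V
    · obtain ⟨q, h1, h2, h3, h4⟩ := ih
      exact ⟨q, by lia, h2, h3.trans h, h4⟩
    · exact ⟨r, le_rfl, hr.le, rfl, h⟩

end Overlap

/-! ### Dimension formulas -/

section Dimension

lemma imageDim_id : imageDim (fun z : ℂ => z) = 1 := by
  let θ : Polynomial ℂ →ₐ[ℂ] (ℂ → ℂ) := Polynomial.aeval fun z => z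
  have hθ : ∀ f z, θ f z = f.eval z := fun f z => by
    change Pi.evalAlgHom ℂ (fun _ => ℂ) z (Polynomial.aeval (fun z => z) f) = _
    rw [← Polynomial.aeval_algHom_apply]
    simp
  have hinj : Function.Injective θ := fun f g h => Polynomial.funext fun z => by
    rw [← hθ, ← hθ, h]
  have hrange : θ.range = pullbackRing (fun z : ℂ => z) := by
    rw [← adjoin_singleton_eq_range_aeval]
    apply le_antisymm
    · rw [adjoin_le_iff, Set.singleton_subset_iff]
      exact dual_mem_pullbackRing (fun z : ℂ => z) LinearMap.id
    · refine pullbackRing_le fun φ => ?_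
      have : (fun z => φ z) = φ 1 • fun z : ℂ => z := by
        ext z
        rw [Pi.smul_apply, smul_eq_mul, mul_comm, ← smul_eq_mul, ← map_smul, smul_eq_mul, mul_one]
      rw [this]
      exact Subalgebra.smul_mem _ (self_mem_adjoin_singleton _ _) _
  rw [imageDim, ← hrange, ← (AlgEquiv.ofInjective θ hinj).trdeg_eq, Polynomial.trdeg_of_isDomain,
    map_one]

lemma imageDim_secSum_point (V : Type*) [AddCommGroup V] [Module ℂ V] :
    imageDim (secSum : SecParam 1 0 0 V → ExteriorAlgebra ℂ V) = 1 := by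
  have h : (secSum : SecParam 1 0 0 V → ExteriorAlgebra ℂ V) =
      fun p => LinearMap.toSpanSingleton ℂ _ 1 (p.1 0) := by
    ext p
    simp [secSum]
  have hinj : Function.Injective (LinearMap.toSpanSingleton ℂ (ExteriorAlgebra ℂ V) 1) :=
    smul_left_injective ℂ one_ne_zero
  refine Eq.trans ?_ ((imageDim_comp_surjective (fun z : ℂ => z)
    (g := fun p : SecParam 1 0 0 V => p.1 0) fun z => ⟨(fun _ => z, 0, 0), rfl⟩).trans imageDim_id)
  rw [h, imageDim, pullbackRing_comp_injective (fun p : SecParam 1 0 0 V => p.1 0) _ hinj, imageDim]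

variable {V : Type*} [AddCommGroup V] [Module ℂ V] [FiniteDimensional ℂ V]

lemma projDim_grassmannian {r n : ℕ} (hn : Module.finrank ℂ V = n) (hr : r ≤ n) :
    projDim (grassmannian r V) = (r : ℤ) * ((n : ℤ) - r) := by
  obtain ⟨e, he, -⟩ := exists_linearIndependent_of_le_finrank (V := V) (r := r) ⊤
    (by rwa [finrank_top, hn])
  have hU : r + Module.finrank ℂ (Fin (n - r) → ℂ) = Module.finrank ℂ V := by
    rw [Module.finrank_fin_fun]
    lia
  obtain ⟨S⟩ := nonempty_splitting he (Fin (n - r) → ℂ) hU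
  -- For m = 0 an annihilating vector outside the span would have to come from a further factor, and
  -- there is none.
  have h1 := S.imageDim_secSum 1 0 (Or.inr ⟨1, 0, fun v hv => by
    by_contra hne
    obtain ⟨m', hm', -⟩ := exists_secSum_succ (m := 0) (1, e, 0)
      (by simpa [secSum] using ιMulti_ne_zero he) hne hv
    lia⟩)
  rw [grassmannian_eq_restrictedSet, projDim_eq_imageDim_of_range_eq _ _
    (Submodule.subtype_injective _) _
    (range_secSum (V := V) (s := 1) (r := r) (m := 0) (k := r) rfl (hn ▸ hr)),
    h1, imageDim_secSum_point, Module.finrank_fin_fun]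
  push_cast [hr]
  ring

/-- The dimension of a restricted secant variety whose overlap cannot be increased. -/
theorem projDim_restrictedSecant_eq {s r k : ℕ} (hrk : r ≤ k) (hkn : k ≤ Module.finrank ℂ V)
    (h : r = 0 ∨ restrictedSecant s (r + 1) k V ≠ restrictedSecant s r k V)
    (U : Type*) [AddCommGroup U] [Module ℂ U] [FiniteDimensional ℂ U]
    (hU : r + Module.finrank ℂ U = Module.finrank ℂ V) :
    projDim (restrictedSecant s r k V) = projDim (grassmannian r V) +
      projDim (secantVariety s (grassmannian (k - r) U)) := by
  obtain ⟨m, rfl⟩ := Nat.exists_eq_add_of_le hrk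
  have he : ∃ e : Fin r → V, LinearIndependent ℂ e ∧ (r = 0 ∨
      ∃ (c : Fin s → ℂ) (f : Fin s → Fin m → V),
        ∀ v, ι ℂ v * secSum (c, e, f) = 0 → v ∈ Submodule.span ℂ (Set.range e)) := by
    rcases h with rfl | h
    · exact ⟨Fin.elim0, linearIndependent_empty_type, Or.inl rfl⟩
    · obtain ⟨⟨c, e, f⟩, hp, hv⟩ := exists_general_secSum rfl hkn h
      exact ⟨e, linearIndependent_of_secSum_ne_zero hp, Or.inr ⟨c, f, hv⟩⟩
  obtain ⟨e, he, hgen⟩ := he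
  obtain ⟨S⟩ := nonempty_splitting he U hU
  rw [projDim_restrictedSecant rfl hkn, S.imageDim_secSum s m hgen, secantVariety_grassmannian,
    Nat.add_sub_cancel_left, projDim_restrictedSecant (Nat.zero_add m).symm (by lia),
    projDim_grassmannian rfl (by lia), ← hU]
  push_cast
  ring

end Dimension

end RestrictedSecant

end

/-! ### Defects and the closed formula -/

theorem corollary2 {V : Type*} [AddCommGroup V] [Module ℂ V] [FiniteDimensional ℂ V]
    (n s r k : ℕ) (hn : Module.finrank ℂ V = n) (hs : 1 ≤ s) (hrk : r ≤ k) (hkn : k ≤ n)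
    (hBDdG : RestrictedSecant.BDdGConjecture) :
    -- every restricted secant variety is one whose overlap cannot be increased
    (∃ q, r ≤ q ∧ q ≤ k ∧
      RestrictedSecant.restrictedSecant s q k V = RestrictedSecant.restrictedSecant s r k V ∧
      RestrictedSecant.restrictedSecant s (q + 1) k V ≠
        RestrictedSecant.restrictedSecant s q k V) ∧
    -- and for such an overlap (or no overlap condition at all) there is no additional defect
    ((r = 0 ∨ RestrictedSecant.restrictedSecant s (r + 1) k V ≠
        RestrictedSecant.restrictedSecant s r k V) →
      (∀ E : Submodule ℂ V, Module.finrank ℂ E = r →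
        RestrictedSecant.restrictedDefect s r k V =
            RestrictedSecant.secantDefect s (RestrictedSecant.grassmannian (k - r) (V ⧸ E)) ∧
        RestrictedSecant.projDim (RestrictedSecant.restrictedSecant s r k V) =
          RestrictedSecant.projDim (RestrictedSecant.grassmannian r V) +
            RestrictedSecant.projDim (RestrictedSecant.secantVariety s
              (RestrictedSecant.grassmannian (k - r) (V ⧸ E)))) ∧
      RestrictedSecant.projDim (RestrictedSecant.restrictedSecant s r k V) =
        RestrictedSecant.projDim (RestrictedSecant.grassmannian r V) +
          RestrictedSecant.projDim (RestrictedSecant.secantVariety s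
            (RestrictedSecant.grassmannian (k - r) (Fin (n - r) → ℂ))) ∧
      (¬ RestrictedSecant.InDefectiveList s (k - r) (n - r) →
        RestrictedSecant.projDim (RestrictedSecant.restrictedSecant s r k V) =
          (r : ℤ) * ((n : ℤ) - r) +
            min (((n - r).choose (k - r) : ℤ) - 1)
              (s * (((k : ℤ) - r) * ((n : ℤ) - k)) + s - 1))) := by
  refine ⟨RestrictedSecant.exists_maximal_overlap hs (hn ▸ hkn) hrk, fun h => ?_⟩
  have hfin := RestrictedSecant.projDim_restrictedSecant_eq hrk (hn ▸ hkn) h (Fin (n - r) → ℂ)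
    (by rw [Module.finrank_fin_fun]; lia)
  refine ⟨fun E hE => ?_, hfin, fun hlist => ?_⟩
  · have hq : r + Module.finrank ℂ (V ⧸ E) = Module.finrank ℂ V := by
      rw [← hE, add_comm, Submodule.finrank_quotient_add_finrank]
    have hE' := RestrictedSecant.projDim_restrictedSecant_eq hrk (hn ▸ hkn) h (V ⧸ E) hq
    refine ⟨?_, hE'⟩
    have hqn : Module.finrank ℂ (V ⧸ E) = n - r := by lia
    -- Virtual and actual dimensions both exceed those of the secant variety for V/E by r(n - r),
    -- which cancels.
    rw [RestrictedSecant.restrictedDefect, RestrictedSecant.secantDefect,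
      RestrictedSecant.virtualDim, RestrictedSecant.restrictedVirtualDim, hE',
      RestrictedSecant.projDim_grassmannian hn (hrk.trans hkn),
      RestrictedSecant.projDim_grassmannian hqn (by lia), hn]
    push_cast [hrk, hrk.trans hkn]
    ring
  · rw [hfin, RestrictedSecant.projDim_grassmannian hn (hrk.trans hkn),
      hBDdG s (k - r) (n - r) hs (by lia) hlist, RestrictedSecant.expectedDim,
      RestrictedSecant.virtualDim, exteriorPower.finrank_eq, Module.finrank_fin_fun,
      RestrictedSecant.projDim_grassmannian (Module.finrank_fin_fun ℂ) (by lia)]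
    push_cast [hrk, hrk.trans hkn]
    ring_nf
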